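/- Let $s:\mathbb R\to\mathbb R$ be strictly increasing and absolutely continuous with $s'\in\{0,1\}$ a.e., and let $G\subset\mathbb R$ be an open set with $G=\{s'=1\}$ up to a Lebesgue-null set, such that $F:=\mathbb R\setminus G$ has positive Lebesgue measure and no isolated points. Let $(\mathcal E,\mathcal F)=(\tfrac12\mathbf D,H^1(\mathbb R))$, $\mathcal E(u,v)=\tfrac12\int u'v'\,dx$, be the Dirichlet form of Brownian motion on $L^2(\mathbb R)$, and let $$\mathcal F^{(s)}=\Big\{u\in L^2(\mathbb R):u\ll s,\ \int\Big(\frac{du}{ds}\Big)^2ds<\infty\Big\},\qquad \mathcal E^{(s)}(u,v)=\frac12\int\frac{du}{ds}\frac{dv}{ds}\,ds .$$ Denote by $\mathcal F_{\rm e}$, $\mathcal F^{(s)}_{\rm e}$ the extended Dirichlet spaces (whose elements are represented by their continuous versions, and to which the forms are extended). Let $\mathcal F_{{\rm e},G}=\{w\in\mathcal F_{\rm e}:w=0\text{ on }F\}$ and $\mathcal H_F=\{h\in\mathcal F_{\rm e}:\mathcal E(h,w)=0\ \text{for all } w\in\mathcal F_{{\rm e},G}\}$; for $u\in\mathcal F_{\rm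 e}$ let $H_Fu$ be the element of $\mathcal H_F$ with $u-H_Fu\in\mathcal F_{{\rm e},G}$. Define $\mathcal F^{(s)}_{{\rm e},G}$, $\mathcal H^{(s)}_F$ and $H^{(s)}_F$ in the same way from $(\mathcal E^{(s)},\mathcal F^{(s)})$. Let $\mu$ be a Radon measure on $F$ with support $F$. The trace $(\check{\mathcal E},\check{\mathcal F})$ of $(\mathcal E,\mathcal F)$ on $F$ relative to $\mu$ is $$\check{\mathcal F}=\{\varphi\in L^2(F,\mu):\varphi=u\ \mu\text{-a.e. on }F\text{ for some }u\in\mathcal F_{\rm e}\},\qquad \check{\mathcal E}(\varphi,\psi)=\mathcal E(H_Fu,H_Fv)$$ for $\varphi=u$, $\psi=v$ $\mu$-a.e. on $F$ with $u,v\in\mathcal F_{\rm e}$, and the trace $(\check{\mathcal E}^{(s)},\check{\mathcal F}^{(s)})$ of $(\mathcal E^{(s)},\mathcal F^{(s)})$ is defined likewise. **Theorem.** $(\check{\mathcal E}^{(s)},\check{\mathcal F}^{(s)})$ is a proper regular subspace of $(\check{\mathcal E},\check{\mathcal F})$: both are regular Dirichlet forms on $L^2(F,\mu)$, $\check{\mathcal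 F}^{(s)}\subsetneq\check{\mathcal F}$, and $\check{\mathcal E}(\varphi,\psi)=\check{\mathcal E}^{(s)}(\varphi,\psi)$ for all $\varphi,\psi\in\check{\mathcal F}^{(s)}$. Moreover, $H_Fu$ exists and is unique for every $u\in\mathcal F_{\rm e}$, $H^{(s)}_Fu$ exists and is unique for every $u\in\mathcal F^{(s)}_{\rm e}$, and $\mathcal F^{(s)}_{\rm e}\subset\mathcal F_{\rm e}$ with $H_Fu=H^{(s)}_Fu$ for every $u\in\mathcal F^{(s)}_{\rm e}$. -/

import Mathlib

open MeasureTheory Set Filter Topology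

noncomputable section

/-! ## Symmetric forms on `L²` and Dirichlet forms -/

/-- The data of a form on `L²(X, μ)`: a set of elements of `L²` (the domain) and a real number
`energy u v` for each pair; the values of `energy` outside the domain are irrelevant.
The laws are in `IsDirichletForm` below. -/
structure L2Form {X : Type*} [MeasurableSpace X] (μ : Measure X) where
  domain : Set (Lp ℝ 2 μ)
  energy : Lp ℝ 2 μ → Lp ℝ 2 μ → ℝ

namespace L2Form

variable {X : Type*} [MeasurableSpace X] {μ : Measure X}

/-- The quadratic form `𝓔₁(u,u) = 𝓔(u,u) + (u,u)_{L²}`. -/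
def energyOne (D : L2Form μ) (u : Lp ℝ 2 μ) : ℝ :=
  D.energy u u + ‖u‖ ^ 2

/-- `D` is a (symmetric) Dirichlet form on `L²(X, μ)`: a densely defined, nonnegative definite,
symmetric bilinear form that is closed and Markovian. -/
structure IsDirichletForm (D : L2Form μ) : Prop where
  zero_mem : (0 : Lp ℝ 2 μ) ∈ D.domain
  add_mem : ∀ u ∈ D.domain, ∀ v ∈ D.domain, u + v ∈ D.domain
  smul_mem : ∀ (c : ℝ), ∀ u ∈ D.domain, c • u ∈ D.domain
  dense : Dense D.domain
  add_left : ∀ u ∈ D.domain, ∀ v ∈ D.domain, ∀ w ∈ D.domain,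
    D.energy (u + v) w = D.energy u w + D.energy v w
  smul_left : ∀ (c : ℝ), ∀ u ∈ D.domain, ∀ v ∈ D.domain,
    D.energy (c • u) v = c * D.energy u v
  symm : ∀ u ∈ D.domain, ∀ v ∈ D.domain, D.energy u v = D.energy v u
  nonneg : ∀ u ∈ D.domain, 0 ≤ D.energy u u
  /-- closedness: the domain is complete for the norm of `𝓔₁` -/
  closed : ∀ u : ℕ → Lp ℝ 2 μ, (∀ n, u n ∈ D.domain) →
    Tendsto (fun p : ℕ × ℕ => D.energyOne (u p.1 - u p.2)) atTop (𝓝 0) →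
    ∃ v ∈ D.domain, Tendsto (fun n => D.energyOne (u n - v)) atTop (𝓝 0)
  /-- Markov property: the unit contraction `0 ∨ u ∧ 1` operates -/
  markov : ∀ u ∈ D.domain, ∀ v : Lp ℝ 2 μ, (v =ᵐ[μ] fun x => max 0 (min (u x) 1)) →
    v ∈ D.domain ∧ D.energy v v ≤ D.energy u u

/-- `D` is a regular Dirichlet form: the intersection of its domain with `C_c(X)` is
`𝓔₁`-dense in the domain and uniformly dense in `C_c(X)`. -/
structure IsRegularDirichletForm [TopologicalSpace X] (D : L2Form μ) : Prop
    extends IsDirichletForm D where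
  dense_domain : ∀ u ∈ D.domain, ∀ ε > (0 : ℝ), ∃ f : X → ℝ, Continuous f ∧ HasCompactSupport f ∧
    ∃ w ∈ D.domain, w =ᵐ[μ] f ∧ D.energyOne (u - w) < ε
  dense_compactSupport : ∀ f : X → ℝ, Continuous f → HasCompactSupport f → ∀ ε > (0 : ℝ),
    ∃ g : X → ℝ, Continuous g ∧ HasCompactSupport g ∧ (∃ w ∈ D.domain, w =ᵐ[μ] g) ∧
      ∀ x, |f x - g x| < ε

/-- `D₁ ≺ D₂`: both are regular Dirichlet forms on the same `L²` space, the domain of `D₁` is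
contained in that of `D₂`, and the forms agree on the smaller domain. -/
structure IsRegularSubspace [TopologicalSpace X] (D₁ D₂ : L2Form μ) : Prop where
  regular_left : D₁.IsRegularDirichletForm
  regular_right : D₂.IsRegularDirichletForm
  subset : D₁.domain ⊆ D₂.domain
  energy_eq : ∀ u ∈ D₁.domain, ∀ v ∈ D₁.domain, D₂.energy u v = D₁.energy u v

/-- A regular subspace with a strictly smaller domain. -/
def IsProperRegularSubspace [TopologicalSpace X] (D₁ D₂ : L2Form μ) : Prop :=
  IsRegularSubspace D₁ D₂ ∧ D₁.domain ≠ D₂.domain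

/-! ## Extended Dirichlet space, harmonic part and trace -/

/-- `f` is an approximating sequence of `u`: it lies in the domain, is Cauchy for the energy, and
converges to `u` almost everywhere. -/
def IsApproxSeq (D : L2Form μ) (f : ℕ → Lp ℝ 2 μ) (u : X → ℝ) : Prop :=
  (∀ n, f n ∈ D.domain) ∧
  Tendsto (fun p : ℕ × ℕ => D.energy (f p.1 - f p.2) (f p.1 - f p.2)) atTop (𝓝 0) ∧
  ∀ᵐ x ∂μ, Tendsto (fun n => f n x) atTop (𝓝 (u x))

/-- The extended Dirichlet space `𝓕_e`: the functions that admit an approximating sequence.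
Its elements are represented by their continuous versions. For the one-dimensional forms below
each element has exactly one, and quasi-continuous versions are the same as continuous ones. -/
def extendedSpace [TopologicalSpace X] (D : L2Form μ) : Set (X → ℝ) :=
  {u | Continuous u ∧ ∃ f, D.IsApproxSeq f u}

/-- The energy `𝓔(u,v)` extended to `𝓕_e`: the common limit of `𝓔(fₙ,gₙ)` over all approximating
sequences `f` of `u` and `g` of `v`. -/
def extendedEnergy (D : L2Form μ) (u v : X → ℝ) : ℝ :=
  Classical.epsilon fun c : ℝ => ∀ f g, D.IsApproxSeq f u → D.IsApproxSeq g v →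
    Tendsto (fun n => D.energy (f n) (g n)) atTop (𝓝 c)

/-- `𝓕_{e,G}`, where `G` is the complement of `F`: the elements of `𝓕_e` that vanish on `F`. -/
def partSpace [TopologicalSpace X] (D : L2Form μ) (F : Set X) : Set (X → ℝ) :=
  {w | w ∈ D.extendedSpace ∧ ∀ x ∈ F, w x = 0}

/-- `𝓗_F`: the elements of `𝓕_e` that are orthogonal to `𝓕_{e,G}`. -/
def harmonicSpace [TopologicalSpace X] (D : L2Form μ) (F : Set X) : Set (X → ℝ) :=
  {u | u ∈ D.extendedSpace ∧ ∀ w ∈ D.partSpace F, D.extendedEnergy u w = 0}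

/-- `h` is the `𝓗_F`-component in a decomposition of `u` along `𝓕_{e,G}` and `𝓗_F`. -/
def IsHarmonicPart [TopologicalSpace X] (D : L2Form μ) (F : Set X) (u h : X → ℝ) : Prop :=
  h ∈ D.harmonicSpace F ∧ u - h ∈ D.partSpace F

/-- `H_F u`, the `𝓗_F`-component of `u`. -/
def harmonicPart [TopologicalSpace X] (D : L2Form μ) (F : Set X) (u : X → ℝ) : X → ℝ :=
  Classical.epsilon fun h => D.IsHarmonicPart F u h

/-- `u ∈ 𝓕_e` and `φ = u` holds `ν`-a.e. on `F`. -/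
def IsExtension [TopologicalSpace X] (D : L2Form μ) (F : Set X) (ν : Measure F)
    (φ : Lp ℝ 2 ν) (u : X → ℝ) : Prop :=
  u ∈ D.extendedSpace ∧ φ =ᵐ[ν] fun x : F => u x

/-- The trace of `D` on `F` relative to the measure `ν` on `F`, a form on `L²(F, ν)`: its domain
consists of the `φ` that agree `ν`-a.e. on `F` with some `u ∈ 𝓕_e`, and the energy of `φ = u|_F`
and `ψ = v|_F` is `𝓔(H_F u, H_F v)`. -/
def trace [TopologicalSpace X] (D : L2Form μ) (F : Set X) (ν : Measure F) : L2Form ν where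
  domain := {φ | ∃ u, D.IsExtension F ν φ u}
  energy φ ψ := D.extendedEnergy
    (D.harmonicPart F (Classical.epsilon fun u => D.IsExtension F ν φ u))
    (D.harmonicPart F (Classical.epsilon fun v => D.IsExtension F ν ψ v))

end L2Form

/-! ## Brownian motion and the forms given by a scale function -/

/-- The continuous version of a function on `ℝ` defined up to null sets (unique if it exists). -/
def continuousVersion (f : ℝ → ℝ) : ℝ → ℝ :=
  Classical.epsilon fun u => Continuous u ∧ f =ᵐ[volume] u

/-- The form `(½𝐃, H¹(ℝ))` of Brownian motion on `L²(ℝ)`: `H¹(ℝ)` is the space of square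
integrable functions with a (locally) absolutely continuous version whose derivative is square
integrable, and `½𝐃(u,v) = ½ ∫ u' v' dx`. -/
def brownianForm : L2Form (volume : Measure ℝ) where
  domain := {f | ∃ u : ℝ → ℝ, f =ᵐ[volume] u ∧ (∀ a b, AbsolutelyContinuousOnInterval u a b) ∧
    MemLp (deriv u) 2 volume}
  energy f g := 1 / 2 * ∫ x, deriv (continuousVersion f) x * deriv (continuousVersion g) x

/-- `g` is a density of `u` with respect to `ds`, that is `u(y) - u(x) = ∫_x^y g ds`. -/
def IsScaleDeriv (s : StieltjesFunction ℝ) (u g : ℝ → ℝ) : Prop :=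
  LocallyIntegrable g s.measure ∧ ∀ x y, u y - u x = ∫ t in x..y, g t ∂s.measure

/-- The density `du/ds` (unique `ds`-a.e. if it exists). -/
def scaleDeriv (s : StieltjesFunction ℝ) (u : ℝ → ℝ) : ℝ → ℝ :=
  Classical.epsilon fun g => IsScaleDeriv s u g

/-- The form `(𝓔⁽ˢ⁾, 𝓕⁽ˢ⁾)` on `L²(ℝ)` of the diffusion with continuous scale function `s` and
speed measure `dx`: `𝓕⁽ˢ⁾` consists of the `u ∈ L²(ℝ)` with `u ≪ s` and `∫ (du/ds)² ds < ∞`, and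
`𝓔⁽ˢ⁾(u,v) = ½ ∫ (du/ds)(dv/ds) ds`. -/
def scaleForm (s : StieltjesFunction ℝ) : L2Form (volume : Measure ℝ) where
  domain := {f | ∃ u : ℝ → ℝ, Continuous u ∧ f =ᵐ[volume] u ∧ (∃ g, IsScaleDeriv s u g) ∧
    MemLp (scaleDeriv s u) 2 s.measure}
  energy f g := 1 / 2 * ∫ x, scaleDeriv s (continuousVersion f) x *
    scaleDeriv s (continuousVersion g) x ∂s.measure

end

/-! Write F for the complement of G. Since s' = 1_G almost everywhere, ds is Lebesgue measure
restricted to G. So u ≪ s with du/ds ∈ L²(ds) means that u is a primitive of an L² function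
vanishing a.e. off G, and both forms are ½⟨u', v'⟩ in L²(ℝ). `IsEnergyForm A` captures this for a
set A charging every interval: A = ℝ is Brownian motion, A = G is the form of s. Its extended space
consists of the `FiniteEnergy A` functions: the density is carried by A, and the function tends to
zero at each end near which A has finite measure. These boundary conditions survive energy limits.
Conversely, `FiniteEnergy.exists_cutoff` approximates such functions by cutoffs that are linear in x
↦ |A ∩ (0, x]|.

The decisive point is that a function vanishing on F has zero derivative a.e. on F: as F has no
isolated points, the derivative is a limit of difference quotients taken inside F
(`ae_eq_zero_of_preperfect`). Its density is thus carried by G whichever form is considered, and the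
boundary conditions hold automatically (`finiteEnergy_of_eqOn_zero`). Hence both forms have the same
functions vanishing on F, with the same closed space V ⊆ L² of densities (`vanishingDensities`). The
harmonic part comes from projecting the density onto V^⊥. As V does not depend on A, the harmonic
parts agree, and each trace energy is ½⟨l, l'⟩ for the densities of the harmonic extensions.

Regularity of the traces rests on completeness of L², closedness of V^⊥, and minimality of harmonic
extensions (`IsHarmonicOff.norm_le`): a truncated or cut off extension need not be harmonic, but its
energy bounds the trace energy.

The inclusion is strict because of tent functions. If v has finite energy on G and equals a tent u
on F, then v' = 0 a.e. on F, and u' = v' a.e. on F because u - v vanishes there. But u' ≠ 0 a.e.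
inside the support of u, while F has positive measure. -/

/-! ## Functions with a square integrable density -/

/-- A function that varies at most `C` times as much as an absolutely continuous function is
absolutely continuous. -/
theorem AbsolutelyContinuousOnInterval.of_abs_sub_le {u v : ℝ → ℝ} {a b C : ℝ}
    (hu : AbsolutelyContinuousOnInterval u a b)
    (h : ∀ x y, |v y - v x| ≤ C * |u y - u x|) : AbsolutelyContinuousOnInterval v a b := by
  unfold AbsolutelyContinuousOnInterval at hu ⊢
  refine squeeze_zero (fun E => Finset.sum_nonneg fun i _ => dist_nonneg) (fun E => ?_)
    (by simpa using Tendsto.const_mul C hu)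
  rw [Finset.mul_sum]
  refine Finset.sum_le_sum fun i _ => ?_
  rw [Real.dist_eq, Real.dist_eq]
  exact h _ _

/-- The derivative of a function that varies at most `C` times as much as `u` is bounded by
`C |u'|`. -/
theorem abs_deriv_le_of_abs_sub_le {u v : ℝ → ℝ} {C c x : ℝ} (hu : HasDerivAt u c x)
    (h : ∀ x y, |v y - v x| ≤ C * |u y - u x|) : |deriv v x| ≤ C * |c| := by
  by_cases hv : DifferentiableAt ℝ v x
  · have h1 := (hasDerivAt_iff_tendsto_slope.1 hv.hasDerivAt).abs
    have h2 := ((hasDerivAt_iff_tendsto_slope.1 hu).abs).const_mul C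
    refine le_of_tendsto_of_tendsto' h1 h2 fun y => ?_
    rw [slope_def_field, slope_def_field, abs_div, abs_div, ← mul_div_assoc]
    gcongr
    exact h x y
  -- Here `deriv v x` has the default value 0. The sign of `C` is not assumed, so nonnegativity is
  -- read off from the difference quotients.
  · have hC : 0 ≤ C * |c| := by
      have h2 := ((hasDerivAt_iff_tendsto_slope.1 hu).abs).const_mul C
      refine ge_of_tendsto' h2 fun y => ?_
      rw [slope_def_field, abs_div, ← mul_div_assoc]
      exact div_nonneg ((abs_nonneg _).trans (h x y)) (abs_nonneg _)
    simpa [deriv_zero_of_not_differentiableAt hv] using hC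

/-- `g ∈ L²(ℝ)` is a density of `u` that vanishes almost everywhere off `A`. -/
structure HasL2Density (A : Set ℝ) (u : ℝ → ℝ) (g : Lp ℝ 2 (volume : Measure ℝ)) : Prop where
  ae_eq_zero : ∀ᵐ x, x ∉ A → g x = 0
  sub_eq : ∀ x y, u y - u x = ∫ t in x..y, g t

theorem MeasureTheory.Lp.locallyIntegrable_two (g : Lp ℝ 2 (volume : Measure ℝ)) :
    LocallyIntegrable g volume :=
  (Lp.memLp g).locallyIntegrable one_le_two

theorem MeasureTheory.Lp.intervalIntegrable_two (g : Lp ℝ 2 (volume : Measure ℝ)) (a b : ℝ) :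
    IntervalIntegrable g volume a b :=
  intervalIntegrable_iff.mpr <|
    (LocallyIntegrable.integrableOn_isCompact (Lp.locallyIntegrable_two g)
      isCompact_uIcc).mono_set uIoc_subset_uIcc

/-- A primitive of a square integrable function. -/
theorem hasL2Density_integral {A : Set ℝ} {g : Lp ℝ 2 (volume : Measure ℝ)}
    (hg : ∀ᵐ x, x ∉ A → g x = 0) (x₀ c : ℝ) :
    HasL2Density A (fun x => c + ∫ t in x₀..x, g t) g where
  ae_eq_zero := hg
  sub_eq x y := by
    have := intervalIntegral.integral_interval_sub_left (Lp.intervalIntegrable_two g x₀ y)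
      (Lp.intervalIntegrable_two g x₀ x)
    rw [← this]; ring

/-- An absolutely continuous function whose derivative is square integrable. -/
theorem hasL2Density_of_absolutelyContinuous {A : Set ℝ} {u : ℝ → ℝ}
    (hu : ∀ a b, AbsolutelyContinuousOnInterval u a b) (h : MemLp (deriv u) 2 volume)
    (hA : ∀ᵐ x, x ∉ A → deriv u x = 0) : HasL2Density A u (h.toLp (deriv u)) where
  ae_eq_zero := by
    filter_upwards [hA, h.coeFn_toLp] with x h1 h2 h3
    rw [h2, h1 h3]
  sub_eq x y := by
    rw [← (hu x y).integral_deriv_eq_sub]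
    refine intervalIntegral.integral_congr_ae ?_
    filter_upwards [h.coeFn_toLp] with x h2 _ using h2.symm

/-- Almost everywhere differentiability of a locally absolutely continuous function. -/
theorem ae_differentiableAt_of_absolutelyContinuous {u : ℝ → ℝ}
    (hu : ∀ a b, AbsolutelyContinuousOnInterval u a b) : ∀ᵐ x, DifferentiableAt ℝ u x := by
  have h : ∀ n : ℕ, ∀ᵐ x, x ∈ uIcc (-(n : ℝ)) n → DifferentiableAt ℝ u x := fun n =>
    (hu _ _).ae_differentiableAt
  filter_upwards [ae_all_iff.2 h] with x hx
  obtain ⟨n, hn⟩ := exists_nat_ge |x|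
  refine hx n ?_
  rw [uIcc_of_le (by linarith [abs_nonneg x])]
  exact abs_le.1 hn

/-- Cauchy–Schwarz against the indicator of `E`. -/
theorem MeasureTheory.Lp.abs_setIntegral_le (g : Lp ℝ 2 (volume : Measure ℝ)) {E : Set ℝ}
    (hE : MeasurableSet E) (hE' : volume E ≠ ⊤) :
    |∫ t in E, g t| ≤ ‖g‖ * √(volume.real E) := by
  rw [← L2.inner_indicatorConstLp_one (𝕜 := ℝ) hE hE' g]
  refine (abs_real_inner_le_norm _ _).trans ?_
  rw [mul_comm, norm_indicatorConstLp (by norm_num) (by norm_num)]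
  simp [Real.sqrt_eq_rpow]

namespace HasL2Density

variable {A B : Set ℝ} {u v : ℝ → ℝ} {g k : Lp ℝ 2 (volume : Measure ℝ)}

theorem mono (hu : HasL2Density A u g) (h : A ⊆ B) : HasL2Density B u g where
  ae_eq_zero := by filter_upwards [hu.ae_eq_zero] with x hx hB using hx fun hA => hB (h hA)
  sub_eq := hu.sub_eq

theorem eq_add_integral (hu : HasL2Density A u g) (x₀ : ℝ) :
    u = fun x => u x₀ + ∫ t in x₀..x, g t := by
  ext x
  rw [← hu.sub_eq x₀ x]; ring

theorem absolutelyContinuous (hu : HasL2Density A u g) (a b : ℝ) :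
    AbsolutelyContinuousOnInterval u a b := by
  rw [hu.eq_add_integral a]
  have h := (Lp.intervalIntegrable_two g a b).absolutelyContinuousOnInterval_intervalIntegral
    left_mem_uIcc
  refine h.of_abs_sub_le (C := 1) fun x y => by simp

theorem continuous (hu : HasL2Density A u g) : Continuous u := by
  rw [hu.eq_add_integral 0]
  exact continuous_const.add
    (intervalIntegral.continuous_primitive (fun a b => Lp.intervalIntegrable_two g a b) 0)

theorem ae_hasDerivAt (hu : HasL2Density A u g) : ∀ᵐ x, HasDerivAt u (g x) x := by
  filter_upwards [LocallyIntegrable.ae_hasDerivAt_integral (Lp.locallyIntegrable_two g)] with x hx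
  rw [hu.eq_add_integral 0]
  exact (hx 0).const_add _

theorem deriv_ae_eq (hu : HasL2Density A u g) : deriv u =ᵐ[volume] g := by
  filter_upwards [hu.ae_hasDerivAt] with x hx using hx.deriv

theorem unique (hu : HasL2Density A u g) (hv : HasL2Density B u k) : g = k :=
  Lp.ext (hu.deriv_ae_eq.symm.trans hv.deriv_ae_eq)

theorem zero : HasL2Density A 0 0 where
  ae_eq_zero := by
    filter_upwards [Lp.coeFn_zero ℝ 2 (volume : Measure ℝ)] with x hx _ using hx
  sub_eq x y := by
    rw [intervalIntegral.integral_congr_ae (g := fun _ => 0)]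
    · simp
    · filter_upwards [Lp.coeFn_zero ℝ 2 (volume : Measure ℝ)] with t ht _ using ht

theorem add (hu : HasL2Density A u g) (hv : HasL2Density A v k) :
    HasL2Density A (u + v) (g + k) where
  ae_eq_zero := by
    filter_upwards [hu.ae_eq_zero, hv.ae_eq_zero, Lp.coeFn_add g k] with x h1 h2 h3 h4
    rw [h3, Pi.add_apply, h1 h4, h2 h4, add_zero]
  sub_eq x y := by
    have h : ∫ t in x..y, (g + k : Lp ℝ 2 volume) t = ∫ t in x..y, (g t + k t) := by
      refine intervalIntegral.integral_congr_ae ?_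
      filter_upwards [Lp.coeFn_add g k] with t ht _ using ht
    rw [h, intervalIntegral.integral_add (Lp.intervalIntegrable_two g x y)
      (Lp.intervalIntegrable_two k x y), ← hu.sub_eq, ← hv.sub_eq]
    simp only [Pi.add_apply]; ring

theorem smul (hu : HasL2Density A u g) (c : ℝ) : HasL2Density A (c • u) (c • g) where
  ae_eq_zero := by
    filter_upwards [hu.ae_eq_zero, Lp.coeFn_smul c g] with x h1 h3 h4
    rw [h3, Pi.smul_apply, h1 h4, smul_zero]
  sub_eq x y := by
    have h : ∫ t in x..y, (c • g : Lp ℝ 2 volume) t = ∫ t in x..y, c * g t := by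
      refine intervalIntegral.integral_congr_ae ?_
      filter_upwards [Lp.coeFn_smul c g] with t ht _ using ht
    rw [h, intervalIntegral.integral_const_mul, ← hu.sub_eq]
    simp only [Pi.smul_apply, smul_eq_mul]; ring

theorem sub (hu : HasL2Density A u g) (hv : HasL2Density A v k) :
    HasL2Density A (u - v) (g - k) := by
  have h := hu.add (hv.smul (-1))
  rwa [neg_one_smul, neg_one_smul, ← sub_eq_add_neg, ← sub_eq_add_neg] at h

theorem eq_const (hu : HasL2Density A u 0) (x y : ℝ) : u x = u y := by
  have h := hu.sub_eq y x
  have h0 := (HasL2Density.zero (A := A)).sub_eq y x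
  simp only [Pi.zero_apply] at h0
  linarith

/-- A function that varies at most `C` times as much as `u` has a density of norm at most
`C ‖du‖`. -/
theorem exists_of_abs_sub_le (hu : HasL2Density A u g) {C : ℝ}
    (h : ∀ x y, |v y - v x| ≤ C * |u y - u x|) :
    ∃ k, HasL2Density A v k ∧ ‖k‖ ≤ C * ‖g‖ := by
  have hac := fun a b => (hu.absolutelyContinuous a b).of_abs_sub_le h
  have hle : ∀ᵐ x, ‖deriv v x‖ ≤ C * ‖g x‖ := by
    filter_upwards [hu.ae_hasDerivAt] with x hx
    exact abs_deriv_le_of_abs_sub_le hx h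
  have hmem : MemLp (deriv v) 2 volume :=
    (Lp.memLp g).of_le_mul (measurable_deriv v).aestronglyMeasurable hle
  refine ⟨hmem.toLp _, hasL2Density_of_absolutelyContinuous hac hmem ?_, ?_⟩
  · filter_upwards [hle, hu.ae_eq_zero] with x h1 h2 h3
    simpa [h2 h3] using h1
  · refine Lp.norm_le_mul_norm_of_ae_le_mul ?_
    filter_upwards [hle, hmem.coeFn_toLp] with x h1 h2
    rwa [h2]

/-- The increments of `u` are bounded by the `L²`-norm of the density and the measure of the part
of the interval in `A`; the density may be changed off the interval. -/
theorem abs_sub_le (hA : MeasurableSet A) (hu : HasL2Density A u g) {x y : ℝ} (hxy : x ≤ y)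
    (hk : ∀ᵐ t, t ∈ Ioc x y → k t = g t) :
    |u y - u x| ≤ ‖k‖ * √(volume.real (A ∩ Ioc x y)) := by
  have hfin : volume (A ∩ Ioc x y) ≠ ⊤ :=
    ((measure_mono inter_subset_right).trans_lt (by simp)).ne
  rw [hu.sub_eq, intervalIntegral.integral_of_le hxy]
  -- On the interval, `g` vanishes off `A` and equals `k` on `A`, so only `k` on `A ∩ Ioc x y`
  -- contributes.
  convert! Lp.abs_setIntegral_le k (hA.inter measurableSet_Ioc) hfin using 2
  rw [← integral_indicator measurableSet_Ioc,
    ← integral_indicator (hA.inter measurableSet_Ioc)]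
  refine integral_congr_ae ?_
  filter_upwards [hu.ae_eq_zero, hk] with t h1 h2
  by_cases ht : t ∈ Ioc x y
  · by_cases hA' : t ∈ A
    · rw [indicator_of_mem ht, indicator_of_mem (mem_inter hA' ht), h2 ht]
    · rw [indicator_of_mem ht, indicator_of_notMem fun h => hA' h.1, h1 hA']
  · rw [indicator_of_notMem ht, indicator_of_notMem fun h => ht h.2]

/-- Reflection at the origin. -/
theorem exists_neg : ∃ r : Lp ℝ 2 (volume : Measure ℝ) →ₗᵢ[ℝ] Lp ℝ 2 (volume : Measure ℝ),
    ∀ {A u g}, HasL2Density A u g → HasL2Density (Neg.neg ⁻¹' A) (fun x => u (-x)) (r g) := by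
  have hp := Measure.measurePreserving_neg (volume : Measure ℝ)
  -- The chain rule turns `g` into `-g(-x)`. One isometry serves all functions, so convergence of
  -- densities is preserved by reflection.
  refine ⟨(LinearIsometryEquiv.neg ℝ).toLinearIsometry.comp
    (Lp.compMeasurePreservingₗᵢ ℝ _ hp), fun {A u g} hu => ?_⟩
  have hco : ⇑(((LinearIsometryEquiv.neg ℝ).toLinearIsometry.comp
      (Lp.compMeasurePreservingₗᵢ ℝ _ hp)) g) =ᵐ[volume] fun x => -g (-x) := by
    change ⇑(-(Lp.compMeasurePreserving _ hp g)) =ᵐ[volume] _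
    filter_upwards [Lp.coeFn_neg (Lp.compMeasurePreserving _ hp g),
      Lp.coeFn_compMeasurePreserving g hp] with x h1 h2
    rw [h1, Pi.neg_apply, h2, Function.comp_apply]
  constructor
  · filter_upwards [hco, hp.quasiMeasurePreserving.ae hu.ae_eq_zero] with x h1 h2 h3
    rw [h1, h2 h3, neg_zero]
  · intro x y
    rw [hu.sub_eq, intervalIntegral.integral_congr_ae (hco.mono fun t ht _ => ht),
      intervalIntegral.integral_neg, intervalIntegral.integral_comp_neg (fun t => g t),
      intervalIntegral.integral_symm]

end HasL2Density

namespace HasL2Density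

variable {A B : Set ℝ} {u v : ℝ → ℝ} {g k : Lp ℝ 2 (volume : Measure ℝ)}

/-- Forgetting `A` gives the classical ½-Hölder bound, which is what controls pointwise limits. -/
theorem abs_sub_le_sqrt (hu : HasL2Density A u g) (x y : ℝ) :
    |u y - u x| ≤ ‖g‖ * √|y - x| := by
  wlog hxy : x ≤ y generalizing x y
  · rw [abs_sub_comm, abs_sub_comm y x]
    exact this y x (not_le.1 hxy).le
  have h := (hu.mono (subset_univ A)).abs_sub_le MeasurableSet.univ hxy (k := g)
    (Eventually.of_forall fun _ _ => rfl)
  rwa [univ_inter, Real.volume_real_Ioc_of_le hxy, ← abs_of_nonneg (sub_nonneg.2 hxy)] at h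

/-- Convergence of the densities and at one point implies pointwise convergence. -/
theorem tendsto_of_tendsto {un : ℕ → ℝ → ℝ} {gn : ℕ → Lp ℝ 2 (volume : Measure ℝ)} {x₀ : ℝ}
    (hn : ∀ n, HasL2Density A (un n) (gn n)) (hv : HasL2Density B v k)
    (hg : Tendsto gn atTop (𝓝 k)) (hx₀ : Tendsto (fun n => un n x₀) atTop (𝓝 (v x₀))) (x : ℝ) :
    Tendsto (fun n => un n x) atTop (𝓝 (v x)) := by
  -- The Hölder bound for `un n - v` carries convergence from `x₀` to `x`.
  have h1 : Tendsto (fun n => ‖gn n - k‖ * √|x - x₀|) atTop (𝓝 0) := by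
    simpa using (tendsto_iff_norm_sub_tendsto_zero.1 hg).mul_const (√|x - x₀|)
  have h2 : Tendsto (fun n => (un n - v) x - (un n - v) x₀) atTop (𝓝 0) :=
    squeeze_zero_norm (fun n => (((hn n).mono (subset_univ A)).sub
      (hv.mono (subset_univ B))).abs_sub_le_sqrt x₀ x) h1
  have h3 := (h2.add hx₀).add_const (v x - v x₀)
  simp only [Pi.sub_apply] at h3
  convert! h3 using 2 <;> ring

/-- An L² limit is an a.e. limit along a subsequence, so being carried by `A` is a closed condition
on densities. -/
theorem ae_eq_zero_of_tendsto {gn : ℕ → Lp ℝ 2 (volume : Measure ℝ)}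
    (hn : ∀ n, ∀ᵐ x, x ∉ A → gn n x = 0) (hg : Tendsto gn atTop (𝓝 k)) :
    ∀ᵐ x, x ∉ A → k x = 0 := by
  obtain ⟨ns, -, hns⟩ := (tendstoInMeasure_of_tendsto_Lp hg).exists_seq_tendsto_ae
  filter_upwards [ae_all_iff.2 hn, hns] with x h1 h2 h3
  refine tendsto_nhds_unique h2 ?_
  simp [h1 _ h3]

theorem abs_sub_le_of_subset (hA : MeasurableSet A) (hu : HasL2Density A u g) {x y : ℝ}
    {E : Set ℝ} (hxy : x ≤ y) (hE : A ∩ Ioc x y ⊆ E) (hE' : volume E ≠ ⊤)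
    (hk : ∀ᵐ t, t ∈ Ioc x y → k t = g t) : |u y - u x| ≤ ‖k‖ * √(volume.real E) := by
  refine (hu.abs_sub_le hA hxy hk).trans ?_
  gcongr

/-- If the part of `A` in `(0, ∞)` has finite measure and `u` comes close to zero near infinity,
then `u` vanishes at infinity. -/
theorem tendsto_atTop_zero (hA : MeasurableSet A) (hu : HasL2Density A u g)
    (hfin : volume (A ∩ Ioi 0) < ⊤) (h : ∀ ε > 0, ∃ᶠ x in atTop, |u x| < ε) :
    Tendsto u atTop (𝓝 0) := by
  -- The measure of `A` beyond `n` tends to zero, hence so does the oscillation of `u` beyond `n`.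
  have hlim : Tendsto (fun n : ℕ => ‖g‖ * √(volume.real (A ∩ Ioi (n : ℝ)))) atTop (𝓝 0) := by
    have h1 : Tendsto (fun n : ℕ => volume (A ∩ Ioi (n : ℝ))) atTop
        (𝓝 (volume (⋂ n : ℕ, A ∩ Ioi (n : ℝ)))) := by
      refine tendsto_measure_iInter_atTop
        (fun n => (hA.inter measurableSet_Ioi).nullMeasurableSet) ?_ ⟨0, by simpa using hfin.ne⟩
      intro m n hmn
      exact inter_subset_inter_right _ (Ioi_subset_Ioi (by exact_mod_cast hmn))
    have h2 : (⋂ n : ℕ, A ∩ Ioi (n : ℝ)) = ∅ := by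
      refine eq_empty_of_forall_notMem fun x hx => ?_
      obtain ⟨n, hn⟩ := exists_nat_ge x
      exact absurd (mem_iInter.1 hx n).2 (not_lt.2 hn)
    rw [h2, measure_empty] at h1
    have h3 := (ENNReal.tendsto_toReal ENNReal.zero_ne_top).comp h1
    simpa [measureReal_def] using (h3.sqrt).const_mul ‖g‖
  rw [Metric.tendsto_atTop]
  intro ε hε
  obtain ⟨n, hn⟩ := (hlim.eventually_lt_const (half_pos hε)).exists
  obtain ⟨x, hxn, hx⟩ := (frequently_atTop.1 (h (ε / 2) (half_pos hε))) n
  refine ⟨x, fun y hy => ?_⟩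
  have hE : volume (A ∩ Ioi (n : ℝ)) ≠ ⊤ := ((measure_mono (inter_subset_inter_right _
    (Ioi_subset_Ioi n.cast_nonneg))).trans_lt hfin).ne
  have h1 := hu.abs_sub_le_of_subset hA (k := g) hy (E := A ∩ Ioi (n : ℝ))
    (inter_subset_inter_right _ fun t ht => lt_of_le_of_lt hxn ht.1) hE
    (Eventually.of_forall fun _ _ => rfl)
  rw [Real.dist_eq, sub_zero]
  have h2 := abs_add_le (u y - u x) (u x)
  rw [sub_add_cancel] at h2
  linarith

/-- Vanishing at infinity passes to limits if the part of `A` in `(0, ∞)` has finite measure. -/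
theorem tendsto_atTop_zero_of_tendsto (hA : MeasurableSet A) {un : ℕ → ℝ → ℝ}
    {gn : ℕ → Lp ℝ 2 (volume : Measure ℝ)} {x₀ : ℝ}
    (hn : ∀ n, HasL2Density A (un n) (gn n)) (hv : HasL2Density A v k)
    (hg : Tendsto gn atTop (𝓝 k)) (hx₀ : Tendsto (fun n => un n x₀) atTop (𝓝 (v x₀)))
    (hfin : volume (A ∩ Ioi 0) < ⊤) (h : ∀ n, Tendsto (un n) atTop (𝓝 0)) :
    Tendsto v atTop (𝓝 0) := by
  have h0 := tendsto_of_tendsto hn hv hg hx₀ 0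
  rw [Metric.tendsto_atTop]
  intro ε hε
  -- Since `A ∩ Ioi 0` has finite measure, this bound makes `un n` converge to `v` uniformly on the
  -- right half line.
  have h1 : Tendsto (fun n => ‖gn n - k‖ * √(volume.real (A ∩ Ioi 0)) + |un n 0 - v 0|)
      atTop (𝓝 0) := by
    have := ((tendsto_iff_norm_sub_tendsto_zero.1 hg).mul_const
      (√(volume.real (A ∩ Ioi 0)))).add (tendsto_iff_norm_sub_tendsto_zero.1 h0)
    simpa using this
  obtain ⟨n, hn'⟩ := (h1.eventually_lt_const (half_pos hε)).exists
  obtain ⟨N, hN⟩ := (Metric.tendsto_atTop.1 (h n)) (ε / 2) (half_pos hε)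
  refine ⟨max N 0, fun x hx => ?_⟩
  have h2 := ((hn n).sub hv).abs_sub_le_of_subset hA (k := gn n - k)
    (le_of_max_le_right hx) (E := A ∩ Ioi 0)
    (inter_subset_inter_right _ fun t ht => ht.1) hfin.ne (Eventually.of_forall fun _ _ => rfl)
  have h3 := hN x (le_of_max_le_left hx)
  rw [Real.dist_eq, sub_zero] at h3 ⊢
  simp only [Pi.sub_apply] at h2
  rw [abs_le] at h2
  have h4 := abs_le.1 (le_refl |un n 0 - v 0|)
  have h5 := abs_lt.1 h3
  rw [abs_lt]
  constructor <;> linarith [h2.1, h2.2, h4.1, h4.2, h5.1, h5.2]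

end HasL2Density

/-- The functions of finite energy on `A`: those with a square integrable density vanishing off
`A` that tend to zero at each end of the line near which `A` has finite measure. -/
structure FiniteEnergy (A : Set ℝ) (u : ℝ → ℝ) : Prop where
  exists_density : ∃ g, HasL2Density A u g
  zero_atTop : volume (A ∩ Ioi 0) < ⊤ → Tendsto u atTop (𝓝 0)
  zero_atBot : volume (A ∩ Iio 0) < ⊤ → Tendsto u atBot (𝓝 0)

theorem volume_preimage_neg_inter_Ioi (A : Set ℝ) :
    volume (Neg.neg ⁻¹' A ∩ Ioi 0) = volume (A ∩ Iio 0) := by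
  rw [← Measure.measure_preimage_neg volume (A ∩ Iio 0)]
  congr 1
  ext x; simp

theorem volume_preimage_neg_inter_Iio (A : Set ℝ) :
    volume (Neg.neg ⁻¹' A ∩ Iio 0) = volume (A ∩ Ioi 0) := by
  rw [← Measure.measure_preimage_neg volume (A ∩ Ioi 0)]
  congr 1
  ext x; simp

namespace FiniteEnergy

variable {A B : Set ℝ} {u v : ℝ → ℝ} {g k : Lp ℝ 2 (volume : Measure ℝ)}

theorem continuous (hu : FiniteEnergy A u) : Continuous u :=
  hu.exists_density.choose_spec.continuous

theorem zero : FiniteEnergy A 0 where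
  exists_density := ⟨0, HasL2Density.zero⟩
  zero_atTop _ := tendsto_const_nhds
  zero_atBot _ := tendsto_const_nhds

theorem add (hu : FiniteEnergy A u) (hv : FiniteEnergy A v) : FiniteEnergy A (u + v) where
  exists_density :=
    let ⟨_, hg⟩ := hu.exists_density
    let ⟨_, hk⟩ := hv.exists_density
    ⟨_, hg.add hk⟩
  zero_atTop h := by simpa [Pi.add_def] using (hu.zero_atTop h).add (hv.zero_atTop h)
  zero_atBot h := by simpa [Pi.add_def] using (hu.zero_atBot h).add (hv.zero_atBot h)

theorem smul (hu : FiniteEnergy A u) (c : ℝ) : FiniteEnergy A (c • u) where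
  exists_density :=
    let ⟨_, hg⟩ := hu.exists_density
    ⟨_, hg.smul c⟩
  zero_atTop h := by simpa [Pi.smul_def] using (hu.zero_atTop h).const_smul c
  zero_atBot h := by simpa [Pi.smul_def] using (hu.zero_atBot h).const_smul c

theorem sub (hu : FiniteEnergy A u) (hv : FiniteEnergy A v) : FiniteEnergy A (u - v) := by
  rw [sub_eq_add_neg, ← neg_one_smul ℝ v]
  exact hu.add (hv.smul (-1))

theorem of_abs_le (hu : FiniteEnergy A u) (hv : ∃ k, HasL2Density A v k) {C : ℝ}
    (h : ∀ x, |v x| ≤ C * |u x|) : FiniteEnergy A v where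
  exists_density := hv
  zero_atTop h' := squeeze_zero_norm h (by simpa using ((hu.zero_atTop h').abs).const_mul C)
  zero_atBot h' := squeeze_zero_norm h (by simpa using ((hu.zero_atBot h').abs).const_mul C)

theorem comp (hu : FiniteEnergy A u) {T : ℝ → ℝ} (hT : ∀ x y, |T y - T x| ≤ |y - x|)
    (hT0 : T 0 = 0) : FiniteEnergy A (T ∘ u) := by
  obtain ⟨g, hg⟩ := hu.exists_density
  obtain ⟨k, hk, -⟩ := hg.exists_of_abs_sub_le (v := T ∘ u) (C := 1)
    (fun x y => by simpa using hT (u x) (u y))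
  exact hu.of_abs_le ⟨k, hk⟩ (C := 1) fun x => by simpa [hT0] using hT 0 (u x)

theorem comp_neg (hu : FiniteEnergy A u) :
    FiniteEnergy (Neg.neg ⁻¹' A) (fun x => u (-x)) where
  exists_density :=
    let ⟨_, hr⟩ := HasL2Density.exists_neg
    let ⟨_, hg⟩ := hu.exists_density
    ⟨_, hr hg⟩
  zero_atTop h := (hu.zero_atBot (by rwa [← volume_preimage_neg_inter_Ioi])).comp tendsto_neg_atTop_atBot
  zero_atBot h := (hu.zero_atTop (by rwa [← volume_preimage_neg_inter_Iio])).comp tendsto_neg_atBot_atTop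

/-- A limit of functions of finite energy whose densities converge. -/
theorem of_tendsto (hA : MeasurableSet A) {un : ℕ → ℝ → ℝ}
    {gn : ℕ → Lp ℝ 2 (volume : Measure ℝ)} {x₀ : ℝ} (hun : ∀ n, FiniteEnergy A (un n))
    (hn : ∀ n, HasL2Density A (un n) (gn n)) (hv : HasL2Density A v k)
    (hg : Tendsto gn atTop (𝓝 k)) (hx₀ : Tendsto (fun n => un n x₀) atTop (𝓝 (v x₀))) :
    FiniteEnergy A v where
  exists_density := ⟨k, hv⟩
  zero_atTop h := HasL2Density.tendsto_atTop_zero_of_tendsto hA hn hv hg hx₀ h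
    fun n => (hun n).zero_atTop h
  zero_atBot h := by
    obtain ⟨r, hr⟩ := HasL2Density.exists_neg
    have h1 := HasL2Density.tendsto_atTop_zero_of_tendsto (hA.preimage measurable_neg)
      (fun n => hr (hn n)) (hr hv) ((r.continuous.tendsto _).comp hg) (x₀ := -x₀)
      (by simpa using hx₀) (by rwa [volume_preimage_neg_inter_Ioi])
      fun n => ((hun n).zero_atBot h).comp tendsto_neg_atTop_atBot
    have h2 := h1.comp tendsto_neg_atBot_atTop
    simpa [Function.comp_def] using h2

/-- If `u` comes close to zero near both ends of the line, it satisfies the boundary conditions. -/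
theorem of_frequently (hA : MeasurableSet A) (hu : HasL2Density A u g)
    (h1 : volume (A ∩ Ioi 0) < ⊤ → ∀ ε > 0, ∃ᶠ x in atTop, |u x| < ε)
    (h2 : volume (A ∩ Iio 0) < ⊤ → ∀ ε > 0, ∃ᶠ x in atBot, |u x| < ε) : FiniteEnergy A u where
  exists_density := ⟨g, hu⟩
  zero_atTop h := hu.tendsto_atTop_zero hA h (h1 h)
  zero_atBot h := by
    obtain ⟨r, hr⟩ := HasL2Density.exists_neg
    have h3 := (hr hu).tendsto_atTop_zero (hA.preimage measurable_neg)
      (by rwa [volume_preimage_neg_inter_Ioi]) fun ε hε =>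
        tendsto_neg_atBot_atTop.frequently (p := fun x => |u (-x)| < ε)
          (by simpa using h2 h ε hε)
    simpa [Function.comp_def] using h3.comp tendsto_neg_atBot_atTop

/-- A compactly supported function satisfies the boundary conditions. -/
theorem of_hasCompactSupport (hu : HasL2Density A u g) (h : HasCompactSupport u) :
    FiniteEnergy A u where
  exists_density := ⟨g, hu⟩
  zero_atTop _ := (hasCompactSupport_iff_eventuallyEq.1 h).tendsto.mono_left
    (by rw [← Filter.coclosedCompact_eq_cocompact.symm]; exact atTop_le_cocompact)
  zero_atBot _ := (hasCompactSupport_iff_eventuallyEq.1 h).tendsto.mono_left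
    (by rw [← Filter.coclosedCompact_eq_cocompact.symm]; exact atBot_le_cocompact)

end FiniteEnergy

/-! ## Functions that are Lipschitz with respect to the measure of `A`, and cutoffs -/

/-- The primitive of the indicator of `A`. -/
noncomputable def indicatorPrimitive (A : Set ℝ) (x : ℝ) : ℝ :=
  ∫ t in (0 : ℝ)..x, A.indicator (fun _ => (1 : ℝ)) t

theorem locallyIntegrable_indicator_one {A : Set ℝ} (hA : MeasurableSet A) :
    LocallyIntegrable (A.indicator fun _ => (1 : ℝ)) volume :=
  (locallyIntegrable_const (1 : ℝ)).indicator hA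

theorem intervalIntegrable_indicator_one {A : Set ℝ} (hA : MeasurableSet A) (a b : ℝ) :
    IntervalIntegrable (A.indicator fun _ => (1 : ℝ)) volume a b :=
  intervalIntegrable_iff.mpr <|
    ((locallyIntegrable_indicator_one hA).integrableOn_isCompact
      isCompact_uIcc).mono_set uIoc_subset_uIcc

theorem indicatorPrimitive_sub {A : Set ℝ} (hA : MeasurableSet A) {x y : ℝ} (hxy : x ≤ y) :
    indicatorPrimitive A y - indicatorPrimitive A x = volume.real (A ∩ Ioc x y) := by
  rw [indicatorPrimitive, indicatorPrimitive, intervalIntegral.integral_interval_sub_left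
    (intervalIntegrable_indicator_one hA _ _) (intervalIntegrable_indicator_one hA _ _),
    intervalIntegral.integral_of_le hxy, integral_indicator_const _ hA, smul_eq_mul, mul_one,
    measureReal_restrict_apply hA]

theorem volume_inter_Ioc_ne_top (A : Set ℝ) (x y : ℝ) : volume (A ∩ Ioc x y) ≠ ⊤ :=
  ((measure_mono inter_subset_right).trans_lt (by simp)).ne

theorem indicatorPrimitive_monotone {A : Set ℝ} (hA : MeasurableSet A) :
    Monotone (indicatorPrimitive A) := fun x y hxy => by
  rw [← sub_nonneg, indicatorPrimitive_sub hA hxy]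
  exact measureReal_nonneg

theorem indicatorPrimitive_strictMono {A : Set ℝ} (hA : MeasurableSet A)
    (hpos : ∀ a b, a < b → 0 < volume (A ∩ Ioo a b)) : StrictMono (indicatorPrimitive A) :=
  fun x y hxy => by
  rw [← sub_pos, indicatorPrimitive_sub hA hxy.le]
  exact ENNReal.toReal_pos ((hpos x y hxy).trans_le
    (measure_mono (inter_subset_inter_right _ Ioo_subset_Ioc_self))).ne'
    (volume_inter_Ioc_ne_top A x y)

theorem abs_indicatorPrimitive_sub_le {A : Set ℝ} (hA : MeasurableSet A) (x y : ℝ) :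
    |indicatorPrimitive A y - indicatorPrimitive A x| ≤ |y - x| := by
  wlog hxy : x ≤ y generalizing x y
  · rw [abs_sub_comm, abs_sub_comm y x]
    exact this y x (not_le.1 hxy).le
  rw [indicatorPrimitive_sub hA hxy, abs_of_nonneg measureReal_nonneg,
    abs_of_nonneg (sub_nonneg.2 hxy), ← Real.volume_real_Ioc_of_le hxy]
  exact measureReal_mono inter_subset_right (by simp)

theorem continuous_indicatorPrimitive {A : Set ℝ} (hA : MeasurableSet A) :
    Continuous (indicatorPrimitive A) :=
  (LipschitzWith.of_dist_le_mul (K := 1) fun x y => by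
    simpa [Real.dist_eq] using abs_indicatorPrimitive_sub_le hA y x).continuous

theorem absolutelyContinuous_indicatorPrimitive {A : Set ℝ} (hA : MeasurableSet A) (a b : ℝ) :
    AbsolutelyContinuousOnInterval (indicatorPrimitive A) a b :=
  (LipschitzWith.of_dist_le_mul (K := 1) fun x y => by
    simpa [Real.dist_eq] using
      abs_indicatorPrimitive_sub_le hA y x).lipschitzOnWith.absolutelyContinuousOnInterval

/-- This is why cutoffs are measured by the primitive of the indicator of `A` and not by length:
their derivatives vanish a.e. off `A`. -/
theorem ae_abs_deriv_le_indicator {A : Set ℝ} (hA : MeasurableSet A) {v : ℝ → ℝ} {C : ℝ}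
    (h : ∀ x y, |v y - v x| ≤ C * |indicatorPrimitive A y - indicatorPrimitive A x|) :
    ∀ᵐ x, |deriv v x| ≤ C * A.indicator (fun _ => (1 : ℝ)) x := by
  filter_upwards [LocallyIntegrable.ae_hasDerivAt_integral
    (locallyIntegrable_indicator_one hA)] with x hx
  have h1 := abs_deriv_le_of_abs_sub_le (hx 0) h
  rwa [abs_of_nonneg (indicator_nonneg (fun _ _ => zero_le_one) _)] at h1

/-- A compactly supported function that is Lipschitz with respect to the measure of `A` has finite
energy on `A`. -/
theorem FiniteEnergy.of_abs_sub_le_indicatorPrimitive {A : Set ℝ} (hA : MeasurableSet A)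
    {v : ℝ → ℝ} {C : ℝ} (hv : HasCompactSupport v)
    (h : ∀ x y, |v y - v x| ≤ C * |indicatorPrimitive A y - indicatorPrimitive A x|) :
    FiniteEnergy A v := by
  have hac := fun a b => (absolutelyContinuous_indicatorPrimitive hA a b).of_abs_sub_le h
  have hle := ae_abs_deriv_le_indicator hA h
  have hmem : MemLp (deriv v) 2 volume := by
    have hi : MemLp ((tsupport v).indicator fun _ => C) 2 volume :=
      memLp_indicator_const 2 hv.isCompact.measurableSet C (Or.inr hv.isCompact.measure_lt_top.ne)
    refine hi.of_le (measurable_deriv v).aestronglyMeasurable ?_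
    filter_upwards [hle] with x hx
    by_cases hxv : x ∈ tsupport v
    · rw [indicator_of_mem hxv, Real.norm_eq_abs, Real.norm_eq_abs]
      refine hx.trans ?_
      by_cases hxA : x ∈ A
      · simpa [hxA] using le_abs_self C
      · simp [hxA]
    · have : deriv v x = 0 := by
        by_contra hne
        exact hxv (support_deriv_subset hne)
      simp [this, hxv]
  refine FiniteEnergy.of_hasCompactSupport
    (hasL2Density_of_absolutelyContinuous hac hmem ?_) hv
  filter_upwards [hle] with x hx hxA
  simpa [hxA] using hx

/-- The restriction of an `L²` function to a half line near infinity has small norm. -/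
theorem exists_norm_tail_le (g : Lp ℝ 2 (volume : Measure ℝ)) {η : ℝ} (hη : 0 < η) (N : ℝ) :
    ∃ n ≥ N, ∃ k : Lp ℝ 2 (volume : Measure ℝ),
      k =ᵐ[volume] (Ioi n).indicator g ∧ ‖k‖ ≤ η := by
  have hint : Integrable (fun x => g x ^ 2) volume := (Lp.memLp g).integrable_sq
  have h1 : Tendsto (fun n : ℕ => ∫ x in Ioi (n : ℝ), g x ^ 2) atTop
      (𝓝 (∫ x in ⋂ n : ℕ, Ioi (n : ℝ), g x ^ 2)) :=
    tendsto_setIntegral_of_antitone (fun n => measurableSet_Ioi)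
      (fun m n hmn => Ioi_subset_Ioi (by exact_mod_cast hmn)) ⟨0, hint.integrableOn⟩
  have h2 : (⋂ n : ℕ, Ioi (n : ℝ)) = ∅ := by
    refine eq_empty_of_forall_notMem fun x hx => ?_
    obtain ⟨n, hn⟩ := exists_nat_ge x
    exact absurd (mem_iInter.1 hx n) (not_lt.2 hn)
  rw [h2, Measure.restrict_empty, integral_zero_measure] at h1
  obtain ⟨n, hn, hnN⟩ := ((h1.eventually_lt_const (pow_pos hη 2)).and
    (tendsto_natCast_atTop_atTop.eventually_ge_atTop N)).exists
  have hmem : MemLp ((Ioi (n : ℝ)).indicator g) 2 volume := (Lp.memLp g).indicator measurableSet_Ioi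
  refine ⟨n, hnN, hmem.toLp _, hmem.coeFn_toLp, ?_⟩
  have h3 : ‖hmem.toLp _‖ ^ 2 = ∫ x in Ioi (n : ℝ), g x ^ 2 := by
    rw [← real_inner_self_eq_norm_sq, L2.inner_def, ← integral_indicator measurableSet_Ioi]
    refine integral_congr_ae ?_
    filter_upwards [hmem.coeFn_toLp] with x hx
    rw [hx]
    by_cases hxn : x ∈ Ioi (n : ℝ)
    · simp only [indicator_of_mem hxn, real_inner_self_eq_norm_sq, Real.norm_eq_abs, sq_abs]
    · simp only [indicator_of_notMem hxn, inner_zero_left]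
  exact (pow_le_pow_iff_left₀ (norm_nonneg _) hη.le two_ne_zero).1 (h3.trans_le hn.le)

/-- On a suitable interval `[n, M]` far out, the square of `u` is small compared with the measure
of `A` in that interval. -/
theorem HasL2Density.exists_abs_le_sqrt {A : Set ℝ} {u : ℝ → ℝ}
    {g k : Lp ℝ 2 (volume : Measure ℝ)} (hA : MeasurableSet A)
    (hpos : ∀ a b, a < b → 0 < volume (A ∩ Ioo a b)) (hu : HasL2Density A u g)
    (h0 : volume (A ∩ Ioi 0) < ⊤ → Tendsto u atTop (𝓝 0)) {n η : ℝ} (hη : 0 < η)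
    (hk : k =ᵐ[volume] (Ioi n).indicator g) (hkη : ‖k‖ ≤ η) :
    ∃ M > n, ∀ x ∈ Icc n M,
      |u x| ≤ 2 * η * √(indicatorPrimitive A M - indicatorPrimitive A n) := by
  have hkg : ∀ x, ∀ᵐ t, t ∈ Ioc n x → k t = g t := fun x => by
    filter_upwards [hk] with t ht htn
    rw [ht, indicator_of_mem (mem_Ioi.2 htn.1)]
  have hinc : ∀ x, n ≤ x → ∀ y, x ≤ y → |u y - u x| ≤
      η * √(indicatorPrimitive A y - indicatorPrimitive A x) := fun x hx y hy => by
    have h1 := hu.abs_sub_le hA hy (k := k) (by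
      filter_upwards [hkg y] with t ht htx using ht ⟨hx.trans_lt htx.1, htx.2⟩)
    rw [indicatorPrimitive_sub hA hy]
    exact h1.trans (by gcongr)
  -- If `A` has finite measure on the right, `u` tends to zero, and its size is controlled by the
  -- measure `R` of `A` beyond `n`. Otherwise the interval can be taken so long that `u n` is
  -- negligible.
  by_cases hfin : volume (A ∩ Ioi 0) < ⊤
  · have hbdd : BddAbove (range (indicatorPrimitive A)) := by
      refine ⟨indicatorPrimitive A 0 + volume.real (A ∩ Ioi 0), ?_⟩
      rintro _ ⟨x, rfl⟩
      rcases le_total x 0 with hx | hx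
      · linarith [indicatorPrimitive_monotone hA hx,
          (measureReal_nonneg : 0 ≤ volume.real (A ∩ Ioi 0))]
      · have h1 := indicatorPrimitive_sub hA hx
        have h2 : volume.real (A ∩ Ioc 0 x) ≤ volume.real (A ∩ Ioi 0) :=
          measureReal_mono (inter_subset_inter_right _ fun t ht => ht.1) hfin.ne
        linarith
    set R := (⨆ x, indicatorPrimitive A x) - indicatorPrimitive A n with hR
    have hRpos : 0 < R := by
      have := indicatorPrimitive_strictMono hA hpos (lt_add_one n)
      have := le_ciSup hbdd (n + 1)
      linarith
    -- More than half of `R` lies before `M`. The weaker factor 4 used below has an exact root,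
    -- whence the constant 2.
    obtain ⟨M, hM⟩ := exists_lt_of_lt_ciSup (show (⨆ x, indicatorPrimitive A x) - R / 2 <
      ⨆ x, indicatorPrimitive A x by linarith)
    have hnM : n < M := by
      refine (indicatorPrimitive_strictMono hA hpos).lt_iff_lt.1 ?_
      linarith
    refine ⟨M, hnM, fun x hx => ?_⟩
    have h1 : |u x| ≤ η * √R := by
      have h2 : ∀ᶠ y in atTop, |u y - u x| ≤ η * √R := by
        filter_upwards [eventually_ge_atTop x] with y hy
        refine (hinc x hx.1 y hy).trans ?_
        gcongr
        linarith [le_ciSup hbdd y, indicatorPrimitive_monotone hA hx.1]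
      have h3 := le_of_tendsto ((h0 hfin).sub_const (u x)).abs h2
      simpa using h3
    have h4 : √R ≤ √(4 * (indicatorPrimitive A M - indicatorPrimitive A n)) :=
      Real.sqrt_le_sqrt (by linarith)
    rw [Real.sqrt_mul (by norm_num), show √(4 : ℝ) = 2 by
      rw [show (4 : ℝ) = 2 ^ 2 by norm_num]; exact Real.sqrt_sq (by norm_num)] at h4
    calc |u x| ≤ η * √R := h1
      _ ≤ η * (2 * √(indicatorPrimitive A M - indicatorPrimitive A n)) := by gcongr
      _ = _ := by ring
  · have htop : ¬ BddAbove (range (indicatorPrimitive A)) := by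
      rintro ⟨C, hC⟩
      refine hfin ?_
      have h1 : A ∩ Ioi (0 : ℝ) = ⋃ m : ℕ, A ∩ Ioc (0 : ℝ) m := by
        ext t
        simp only [mem_inter_iff, mem_Ioi, mem_iUnion, mem_Ioc]
        constructor
        · rintro ⟨h1, h2⟩
          obtain ⟨m, hm⟩ := exists_nat_ge t
          exact ⟨m, h1, h2, hm⟩
        · rintro ⟨m, h1, h2, -⟩
          exact ⟨h1, h2⟩
      have h2 : Monotone fun m : ℕ => A ∩ Ioc (0 : ℝ) m := fun m m' hm =>
        inter_subset_inter_right _ (Ioc_subset_Ioc_right (by exact_mod_cast hm))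
      rw [h1, h2.measure_iUnion]
      refine lt_of_le_of_lt (iSup_le fun m => ?_) (ENNReal.ofReal_lt_top
        (r := C - indicatorPrimitive A 0))
      rw [← ofReal_measureReal (volume_inter_Ioc_ne_top A 0 m),
        ← indicatorPrimitive_sub hA m.cast_nonneg]
      exact ENNReal.ofReal_le_ofReal (by linarith [hC (mem_range_self (m : ℝ))])
    -- With this much measure of `A` in the interval, `|u n|` costs one `η` and the increment from
    -- `n` the other.
    obtain ⟨_, ⟨M', rfl⟩, hM'⟩ := not_bddAbove_iff.1 htop
      (indicatorPrimitive A n + (u n / η) ^ 2)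
    set M := max M' (n + 1)
    have hM : indicatorPrimitive A n + (u n / η) ^ 2 ≤ indicatorPrimitive A M :=
      hM'.le.trans (indicatorPrimitive_monotone hA (le_max_left _ _))
    refine ⟨M, lt_of_lt_of_le (lt_add_one n) (le_max_right _ _), fun x hx => ?_⟩
    have h1 := hinc n le_rfl x hx.1
    have h2 : |u n| ≤ η * √(indicatorPrimitive A M - indicatorPrimitive A n) := by
      have h3 : √((u n / η) ^ 2) ≤ √(indicatorPrimitive A M - indicatorPrimitive A n) :=
        Real.sqrt_le_sqrt (by linarith)
      rw [Real.sqrt_sq_eq_abs, abs_div, abs_of_pos hη, div_le_iff₀ hη] at h3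
      linarith
    have h4 : η * √(indicatorPrimitive A x - indicatorPrimitive A n) ≤
        η * √(indicatorPrimitive A M - indicatorPrimitive A n) := by
      gcongr
      exact indicatorPrimitive_monotone hA hx.2
    have h5 := abs_add_le (u x - u n) (u n)
    rw [sub_add_cancel] at h5
    linarith

theorem abs_clamp_sub_clamp_le (a b x y : ℝ) :
    |max a (min b y) - max a (min b x)| ≤ |y - x| :=
  (abs_max_sub_max_le_max _ _ _ _).trans <| by
    rw [sub_self, abs_zero, max_eq_right (abs_nonneg _)]
    refine (abs_min_sub_min_le_max _ _ _ _).trans ?_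
    rw [sub_self, abs_zero, max_eq_right (abs_nonneg _)]

/-- A cutoff near `+∞` that changes the density of `u` little. -/
theorem HasL2Density.exists_right_cutoff {A : Set ℝ} {u : ℝ → ℝ}
    {g : Lp ℝ 2 (volume : Measure ℝ)} (hA : MeasurableSet A)
    (hpos : ∀ a b, a < b → 0 < volume (A ∩ Ioo a b)) (hu : HasL2Density A u g)
    (h0 : volume (A ∩ Ioi 0) < ⊤ → Tendsto u atTop (𝓝 0)) (N : ℝ) {ε : ℝ} (hε : 0 < ε) :
    ∃ φ : ℝ → ℝ, Continuous φ ∧ (∀ x, φ x ∈ Icc (0 : ℝ) 1) ∧ (∀ x ≤ N, φ x = 1) ∧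
      (∃ M, ∀ x ≥ M, φ x = 0) ∧ ∃ k, HasL2Density A (u * φ) k ∧ ‖k - g‖ ≤ ε := by
  obtain ⟨n, hnN, k, hk, hkη⟩ := exists_norm_tail_le g (show 0 < ε / 3 by positivity) N
  obtain ⟨M, hnM, hM⟩ := hu.exists_abs_le_sqrt hA hpos h0 (by positivity) hk hkη
  -- The derivative of `u * φ` differs from `g` by `g * (φ - 1)`, of norm at most `η`, and `u * φ'`,
  -- of norm at most `2 * η`.
  set η := ε / 3 with hη
  set S := indicatorPrimitive A with hS
  set L := S M - S n with hL
  have hLpos : 0 < L := sub_pos.2 (indicatorPrimitive_strictMono hA hpos hnM)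
  have hmono : Monotone S := indicatorPrimitive_monotone hA
  -- The cutoff falls from 1 to 0 linearly in `S`, so that |φ'| ≤ 1_A / L.
  set φ : ℝ → ℝ := fun x => max 0 (min 1 (1 - (S x - S n) / L)) with hφ
  have hφ_cont : Continuous φ := by
    have := continuous_indicatorPrimitive hA
    fun_prop
  have hφ_mem : ∀ x, φ x ∈ Icc (0 : ℝ) 1 := fun x =>
    ⟨le_max_left _ _, max_le zero_le_one (min_le_left _ _)⟩
  have hφ_one : ∀ x ≤ n, φ x = 1 := fun x hx => by
    have : 1 ≤ 1 - (S x - S n) / L := by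
      have := div_nonpos_of_nonpos_of_nonneg (sub_nonpos.2 (hmono hx)) hLpos.le
      linarith
    simp only [hφ, min_eq_left this, max_eq_right zero_le_one]
  have hφ_zero : ∀ x ≥ M, φ x = 0 := fun x hx => by
    have : 1 - (S x - S n) / L ≤ 0 := by
      have h1 : 1 ≤ (S x - S n) / L := by
        rw [le_div_iff₀ hLpos]
        linarith [hmono hx]
      linarith
    simp only [hφ]
    exact max_eq_left ((min_le_right _ _).trans this)
  have hφ_lip : ∀ x y, |φ y - φ x| ≤ 1 / L * |S y - S x| := fun x y => by
    refine (abs_clamp_sub_clamp_le _ _ _ _).trans_eq ?_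
    rw [show 1 - (S y - S n) / L - (1 - (S x - S n) / L) = -(1 / L * (S y - S x)) by ring, abs_neg,
      abs_mul, abs_of_pos (by positivity : 0 < 1 / L)]
  have hφ_ac := fun a b => (absolutelyContinuous_indicatorPrimitive hA a b).of_abs_sub_le hφ_lip
  have hac := fun a b => (hu.absolutelyContinuous a b).mul (hφ_ac a b)
  have hE : MeasurableSet (A ∩ Ioc n M) := hA.inter measurableSet_Ioc
  -- This dominates `u * φ'`: on `A ∩ Ioc n M`, |u| ≤ 2η√L and |φ'| ≤ 1/L. Its norm is exactly `2 *
  -- η`, as `L` is the measure of that set.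
  set e := indicatorConstLp 2 hE (volume_inter_Ioc_ne_top A n M) (2 * η / √L) with he
  have hderiv : ∀ᵐ x, deriv (u * φ) x = g x * φ x + u x * deriv φ x := by
    filter_upwards [hu.ae_hasDerivAt, ae_differentiableAt_of_absolutelyContinuous hφ_ac]
      with x h1 h2
    exact (h1.mul h2.hasDerivAt).deriv
  have hbound : ∀ᵐ x, |deriv (u * φ) x - g x| ≤ |k x| + |e x| := by
    filter_upwards [hderiv, hk, ae_abs_deriv_le_indicator hA hφ_lip,
      indicatorConstLp_coeFn (μ := volume) (p := 2) (hs := hE)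
        (hμs := volume_inter_Ioc_ne_top A n M) (c := 2 * η / √L),
      compl_mem_ae_iff.2 (measure_singleton n),
      compl_mem_ae_iff.2 (measure_singleton M)] with x h1 h2 h3 h4 h5 h6
    rw [h1]
    rcases lt_or_gt_of_ne h5 with hx | hx
    · have hd : deriv φ x = 0 := by
        have : φ =ᶠ[𝓝 x] fun _ => 1 := by
          filter_upwards [Iio_mem_nhds hx] with y hy using hφ_one y hy.le
        rw [this.deriv_eq, deriv_const]
      rw [hd, hφ_one x hx.le, mul_one, mul_zero, add_zero, sub_self, abs_zero]
      positivity
    · rw [h2, indicator_of_mem (mem_Ioi.2 hx)]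
      have h7 : |g x * φ x - g x| ≤ |g x| := by
        rw [show g x * φ x - g x = -(g x * (1 - φ x)) by ring, abs_neg, abs_mul,
          abs_of_nonneg (sub_nonneg.2 (hφ_mem x).2)]
        exact mul_le_of_le_one_right (abs_nonneg _) (by linarith [(hφ_mem x).1])
      have h8 : |u x * deriv φ x| ≤ |e x| := by
        rcases lt_or_gt_of_ne h6 with hx' | hx'
        · rw [abs_mul]
          by_cases hxA : x ∈ A
          · rw [indicator_of_mem hxA, mul_one] at h3
            rw [he, h4, indicator_of_mem (mem_inter hxA (mem_Ioc.2 ⟨hx, hx'.le⟩)),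
              abs_of_nonneg (by positivity : 0 ≤ 2 * η / √L)]
            calc |u x| * |deriv φ x| ≤ 2 * η * √L * (1 / L) := by
                  gcongr
                  exact hM x ⟨hx.le, hx'.le⟩
              _ = 2 * η / √L := by
                  rw [mul_one_div, mul_div_assoc, Real.sqrt_div_self', mul_one_div]
          · rw [indicator_of_notMem hxA, mul_zero] at h3
            rw [le_antisymm h3 (abs_nonneg _), mul_zero]
            positivity
        · have hd : deriv φ x = 0 := by
            have : φ =ᶠ[𝓝 x] fun _ => 0 := by
              filter_upwards [Ioi_mem_nhds hx'] with y hy using hφ_zero y (le_of_lt hy)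
            rw [this.deriv_eq, deriv_const]
          rw [hd, mul_zero, abs_zero]
          positivity
      calc |g x * φ x + u x * deriv φ x - g x| = |(g x * φ x - g x) + u x * deriv φ x| := by
            ring_nf
        _ ≤ |g x * φ x - g x| + |u x * deriv φ x| := abs_add_le _ _
        _ ≤ _ := add_le_add h7 h8
  have hdiff : MemLp (fun x => deriv (u * φ) x - g x) 2 volume := by
    refine MemLp.of_le (((Lp.memLp k).abs).add (Lp.memLp e).abs)
      ((measurable_deriv _).aestronglyMeasurable.sub (Lp.memLp g).1) ?_
    filter_upwards [hbound] with x hx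
    simpa only [Pi.add_apply, Real.norm_eq_abs, Pi.abs_apply] using hx.trans (le_abs_self _)
  have hmem : MemLp (deriv (u * φ)) 2 volume := by
    convert! hdiff.add (Lp.memLp g) using 1
    ext x; simp
  refine ⟨φ, hφ_cont, hφ_mem, fun x hx => hφ_one x (hx.trans hnN), ⟨M, hφ_zero⟩, hmem.toLp _,
    hasL2Density_of_absolutelyContinuous hac hmem ?_, ?_⟩
  · filter_upwards [hderiv, hu.ae_eq_zero, ae_abs_deriv_le_indicator hA hφ_lip] with x h1 h2 h3 h4
    rw [indicator_of_notMem h4, mul_zero] at h3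
    rw [h1, h2 h4, abs_eq_zero.1 (le_antisymm h3 (abs_nonneg _)), zero_mul, mul_zero, add_zero]
  · have h1 : ‖hmem.toLp _ - g‖ ≤ ‖|k| + |e|‖ := by
      refine Lp.norm_le_norm_of_ae_le ?_
      filter_upwards [hbound, hmem.coeFn_toLp, Lp.coeFn_sub (hmem.toLp _) g, Lp.coeFn_abs k,
        Lp.coeFn_abs e, Lp.coeFn_add |k| |e|] with x h1 h2 h3 h4 h5 h6
      rw [h3, h6, Pi.sub_apply, Pi.add_apply, h2, h4, h5]
      exact h1.trans (le_abs_self _)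
    have h2 : ‖e‖ = 2 * η := by
      rw [he, norm_indicatorConstLp (by norm_num) (by norm_num), ← indicatorPrimitive_sub hA hnM.le]
      rw [ENNReal.toReal_ofNat, ← Real.sqrt_eq_rpow, Real.norm_eq_abs,
        abs_of_nonneg (by positivity)]
      exact div_mul_cancel₀ _ (Real.sqrt_pos.2 hLpos).ne'
    calc _ ≤ _ := h1
      _ ≤ ‖|k|‖ + ‖|e|‖ := norm_add_le _ _
      _ ≤ η + 2 * η := by
          rw [norm_abs_eq_norm, norm_abs_eq_norm, h2]
          linarith
      _ = ε := by rw [hη]; ring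

/-- Functions of finite energy can be cut off outside a large interval at the price of a small
change of the density. -/
theorem FiniteEnergy.exists_cutoff {A : Set ℝ} {u : ℝ → ℝ} {g : Lp ℝ 2 (volume : Measure ℝ)}
    (hA : MeasurableSet A) (hpos : ∀ a b, a < b → 0 < volume (A ∩ Ioo a b))
    (hu : FiniteEnergy A u) (hg : HasL2Density A u g) (N : ℝ) {ε : ℝ} (hε : 0 < ε) :
    ∃ φ : ℝ → ℝ, Continuous φ ∧ HasCompactSupport φ ∧ (∀ x, φ x ∈ Icc (0 : ℝ) 1) ∧
      (∀ x ∈ Icc (-N) N, φ x = 1) ∧ ∃ k, HasL2Density A (u * φ) k ∧ ‖k - g‖ ≤ ε := by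
  obtain ⟨φ, hφc, hφ, hφ1, ⟨M, hφ0⟩, k, hk, hkg⟩ :=
    hg.exists_right_cutoff hA hpos hu.zero_atTop N (half_pos hε)
  have hfe : FiniteEnergy A (u * φ) := hu.of_abs_le ⟨k, hk⟩ (C := 1) fun x => by
    rw [Pi.mul_apply, abs_mul, one_mul, abs_of_nonneg (hφ x).1]
    exact mul_le_of_le_one_right (abs_nonneg _) (hφ x).2
  -- The left end is treated by reflecting the function already cut off on the right.
  obtain ⟨r, hr⟩ := HasL2Density.exists_neg
  have hpos' : ∀ a b, a < b → 0 < volume (Neg.neg ⁻¹' A ∩ Ioo a b) := fun a b hab => by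
    rw [← Measure.measure_preimage_neg]
    convert! hpos (-b) (-a) (neg_lt_neg hab) using 2
    ext x; simp [and_comm]
  obtain ⟨ψ, hψc, hψ, hψ1, ⟨M', hψ0⟩, l, hl, hlk⟩ :=
    (hr hk).exists_right_cutoff (hA.preimage measurable_neg) hpos'
      hfe.comp_neg.zero_atTop N (half_pos hε)
  have h1 : HasL2Density A (u * fun x => φ x * ψ (-x)) (r l) := by
    have h := hr hl
    simp only [preimage_preimage, neg_neg, preimage_id'] at h
    convert! h using 1
    ext x; simp [mul_assoc]
  have h2 : r (r k) = k := by
    have h := hr (hr hk)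
    simp only [preimage_preimage, neg_neg, preimage_id'] at h
    exact h.unique hk
  refine ⟨fun x => φ x * ψ (-x), hφc.mul (hψc.comp continuous_neg), ?_, fun x => ?_,
    fun x hx => ?_, r l, h1, ?_⟩
  · refine HasCompactSupport.of_support_subset_isCompact (isCompact_Icc (a := -M') (b := M))
      fun x hx => ⟨?_, ?_⟩
    · by_contra h
      exact hx (by simp [hψ0 (-x) (by linarith [not_le.1 h])])
    · by_contra h
      exact hx (by simp [hφ0 x (by linarith [not_le.1 h])])
  · exact ⟨mul_nonneg (hφ x).1 (hψ _).1, mul_le_one₀ (hφ x).2 (hψ _).1 (hψ _).2⟩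
  · simp only [hφ1 x hx.2, hψ1 (-x) (by linarith [hx.1]), mul_one]
  · calc ‖r l - g‖ = ‖r (l - r k) + (k - g)‖ := by rw [map_sub, h2]; congr 1; abel
      _ ≤ ‖r (l - r k)‖ + ‖k - g‖ := norm_add_le _ _
      _ ≤ ε / 2 + ε / 2 := by rw [r.norm_map]; exact add_le_add hlk hkg
      _ = ε := add_halves ε

/-! ## Extended Dirichlet spaces -/

/-- Translates Cauchy sequences for the energy into Cauchy sequences of densities in L². -/
theorem tendsto_half_norm_sub_sq_iff_cauchySeq {E : Type*} [SeminormedAddCommGroup E] {g : ℕ → E} :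
    Tendsto (fun p : ℕ × ℕ => 1 / 2 * ‖g p.1 - g p.2‖ ^ 2) atTop (𝓝 0) ↔ CauchySeq g := by
  rw [cauchySeq_iff_tendsto_dist_atTop_0]
  simp only [dist_eq_norm]
  constructor
  · intro h
    have h1 := (h.const_mul 2).sqrt
    simpa [← mul_assoc, Real.sqrt_sq] using h1
  · intro h
    simpa only [zero_pow two_ne_zero, mul_zero] using (h.pow 2).const_mul (1 / 2)

/-- An `L²` function with a square integrable density has finite energy. -/
theorem HasL2Density.finiteEnergy_of_memLp {A : Set ℝ} {u : ℝ → ℝ}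
    {g : Lp ℝ 2 (volume : Measure ℝ)} (hA : MeasurableSet A) (hu : HasL2Density A u g)
    (h : MemLp u 2 volume) : FiniteEnergy A u := by
  -- By Chebyshev, an L² function cannot stay above `ε` in absolute value on a half line.
  have key : ∀ ε > 0, volume {x | ε ≤ |u x|} < ⊤ := fun ε hε => by
    have h1 := h.meas_ge_lt_top two_ne_zero ENNReal.ofNat_ne_top (ε := ε.toNNReal)
      (by simpa using hε)
    convert! h1 using 3
    ext x
    rw [Real.toNNReal_le_iff_le_coe, coe_nnnorm, Real.norm_eq_abs]
  refine FiniteEnergy.of_frequently hA hu (fun _ ε hε hev => ?_) fun _ ε hε hev => ?_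
  · obtain ⟨N, hN⟩ := eventually_atTop.1 hev
    refine (key ε hε).ne (measure_mono_top (s₁ := Ici N) (fun x hx => ?_) Real.volume_Ici)
    exact not_lt.1 (hN x hx)
  · obtain ⟨N, hN⟩ := eventually_atBot.1 hev
    refine (key ε hε).ne (measure_mono_top (s₁ := Iic N) (fun x hx => ?_) Real.volume_Iic)
    exact not_lt.1 (hN x hx)

/-- `D` is the form `½ ∫ u' v' dx` on the `L²` functions with a square integrable density that
vanishes off `A`. -/
structure IsEnergyForm (A : Set ℝ) (D : L2Form (volume : Measure ℝ)) : Prop where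
  measurableSet : MeasurableSet A
  pos : ∀ a b, a < b → 0 < volume (A ∩ Ioo a b)
  mem_domain_iff : ∀ f, f ∈ D.domain ↔ ∃ u g, HasL2Density A u g ∧ f =ᵐ[volume] u
  energy_eq : ∀ {f f' : Lp ℝ 2 (volume : Measure ℝ)} {u u' g g'}, HasL2Density A u g → HasL2Density A u' g' →
    f =ᵐ[volume] u → f' =ᵐ[volume] u' → D.energy f f' = 1 / 2 * inner ℝ g g'

namespace IsEnergyForm

variable {A : Set ℝ} {D : L2Form (volume : Measure ℝ)} {u v : ℝ → ℝ}
  {g k : Lp ℝ 2 (volume : Measure ℝ)}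

theorem energy_self (hD : IsEnergyForm A D) {f : Lp ℝ 2 (volume : Measure ℝ)}
    (hu : HasL2Density A u g) (hf : f =ᵐ[volume] u) : D.energy f f = 1 / 2 * ‖g‖ ^ 2 := by
  rw [hD.energy_eq hu hu hf hf, real_inner_self_eq_norm_sq]

theorem energy_sub_self (hD : IsEnergyForm A D) {f f' : Lp ℝ 2 (volume : Measure ℝ)}
    (hu : HasL2Density A u g) (hv : HasL2Density A v k) (hf : f =ᵐ[volume] u)
    (hf' : f' =ᵐ[volume] v) : D.energy (f - f') (f - f') = 1 / 2 * ‖g - k‖ ^ 2 :=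
  hD.energy_self (hu.sub hv) ((Lp.coeFn_sub f f').trans (hf.sub hf'))

/-- The densities along an approximating sequence converge to the density of the limit. -/
theorem exists_of_isApproxSeq (hD : IsEnergyForm A D) {f : ℕ → Lp ℝ 2 (volume : Measure ℝ)}
    (hu : Continuous u) (hf : D.IsApproxSeq f u) :
    ∃ (un : ℕ → ℝ → ℝ) (gn : ℕ → Lp ℝ 2 (volume : Measure ℝ)) (k : Lp ℝ 2 (volume : Measure ℝ)),
      (∀ n, HasL2Density A (un n) (gn n)) ∧ (∀ n, f n =ᵐ[volume] un n) ∧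
      Tendsto gn atTop (𝓝 k) ∧ HasL2Density A u k ∧ FiniteEnergy A u := by
  obtain ⟨hdom, hcau, hlim⟩ := hf
  choose un gn hun hfun using fun n => (hD.mem_domain_iff (f n)).1 (hdom n)
  have hcau' : CauchySeq gn := by
    rw [← tendsto_half_norm_sub_sq_iff_cauchySeq]
    refine hcau.congr fun p => hD.energy_sub_self (hun _) (hun _) (hfun _) (hfun _)
  obtain ⟨k, hk⟩ := cauchySeq_tendsto_of_complete hcau'
  have hlim' : ∀ᵐ x, Tendsto (fun n => un n x) atTop (𝓝 (u x)) := by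
    filter_upwards [hlim, ae_all_iff.2 hfun] with x h1 h2
    simpa only [h2] using h1
  obtain ⟨x₀, hx₀⟩ := hlim'.exists
  -- The limit density determines the limit function once its value at one point of convergence is
  -- known. It equals `u` a.e., hence everywhere by continuity.
  have hv := hasL2Density_integral
    (HasL2Density.ae_eq_zero_of_tendsto (fun n => (hun n).ae_eq_zero) hk) x₀ (u x₀)
  have hx₀' : Tendsto (fun n => un n x₀) atTop (𝓝 ((fun x => u x₀ + ∫ t in x₀..x, k t) x₀)) := by
    simpa using hx₀
  have huv : u = fun x => u x₀ + ∫ t in x₀..x, k t := by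
    refine (hu.ae_eq_iff_eq volume hv.continuous).1 ?_
    filter_upwards [hlim'] with x hx
    exact tendsto_nhds_unique hx (HasL2Density.tendsto_of_tendsto hun hv hk hx₀' x)
  rw [← huv] at hv
  refine ⟨un, gn, k, hun, hfun, hk, hv, ?_⟩
  exact FiniteEnergy.of_tendsto hD.measurableSet (fun n => (hun n).finiteEnergy_of_memLp
    hD.measurableSet ((memLp_congr_ae (hfun n)).1 (Lp.memLp _))) hun hv hk hx₀

/-- The cutoffs equal to one on [-n, n] and changing the density by at most 1/(n+1) do it: they are
continuous with compact support, hence in L². -/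
theorem exists_isApproxSeq (hD : IsEnergyForm A D) (hu : FiniteEnergy A u) :
    ∃ f, D.IsApproxSeq f u := by
  obtain ⟨g, hg⟩ := hu.exists_density
  choose φ hφc hφs hφ hφ1 k hk hkg using fun n : ℕ =>
    hu.exists_cutoff hD.measurableSet hD.pos hg n (Nat.one_div_pos_of_nat (α := ℝ) (n := n))
  have hmem : ∀ n, MemLp (u * φ n) 2 volume := fun n =>
    (hu.continuous.mul (hφc n)).memLp_of_hasCompactSupport (hφs n).mul_left
  have hk_lim : Tendsto k atTop (𝓝 g) := tendsto_iff_norm_sub_tendsto_zero.2 <|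
    squeeze_zero (fun _ => norm_nonneg _) hkg tendsto_one_div_add_atTop_nhds_zero_nat
  refine ⟨fun n => (hmem n).toLp _, fun n => (hD.mem_domain_iff _).2
    ⟨_, _, hk n, (hmem n).coeFn_toLp⟩, ?_, ?_⟩
  · refine (tendsto_half_norm_sub_sq_iff_cauchySeq.2 hk_lim.cauchySeq).congr fun p => ?_
    exact (hD.energy_sub_self (hk _) (hk _) (hmem _).coeFn_toLp (hmem _).coeFn_toLp).symm
  · filter_upwards [ae_all_iff.2 fun n => (hmem n).coeFn_toLp] with x hx
    obtain ⟨N, hN⟩ := exists_nat_ge |x|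
    refine tendsto_const_nhds.congr' ?_
    filter_upwards [eventually_ge_atTop N] with n hn
    have hxn : |x| ≤ n := hN.trans (by exact_mod_cast hn)
    rw [hx n, Pi.mul_apply, hφ1 n x (abs_le.1 hxn), mul_one]

theorem mem_extendedSpace_iff (hD : IsEnergyForm A D) : u ∈ D.extendedSpace ↔ FiniteEnergy A u := by
  constructor
  · rintro ⟨hu, f, hf⟩
    obtain ⟨-, -, -, -, -, -, -, h⟩ := hD.exists_of_isApproxSeq hu hf
    exact h
  · exact fun h => ⟨h.continuous, hD.exists_isApproxSeq h⟩

/-- Along every approximating sequence the densities converge in L² to that of the limit, so the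
limit of the energies is forced. Approximating sequences exist, so the chosen value must be this
one. -/
theorem extendedEnergy_eq (hD : IsEnergyForm A D) (hu : FiniteEnergy A u) (hv : FiniteEnergy A v)
    (hg : HasL2Density A u g) (hk : HasL2Density A v k) :
    D.extendedEnergy u v = 1 / 2 * inner ℝ g k := by
  have key : ∀ f f', D.IsApproxSeq f u → D.IsApproxSeq f' v →
      Tendsto (fun n => D.energy (f n) (f' n)) atTop (𝓝 (1 / 2 * inner ℝ g k)) := by
    intro f f' hf hf'
    obtain ⟨un, gn, l, hun, hfun, hl, hul, -⟩ := hD.exists_of_isApproxSeq hu.continuous hf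
    obtain ⟨vn, kn, m, hvn, hfvn, hm, hvm, -⟩ := hD.exists_of_isApproxSeq hv.continuous hf'
    rw [hg.unique hul, hk.unique hvm]
    refine ((hl.inner hm).const_mul (1 / 2)).congr fun n => ?_
    exact (hD.energy_eq (hun n) (hvn n) (hfun n) (hfvn n)).symm
  obtain ⟨f, hf⟩ := hD.exists_isApproxSeq hu
  obtain ⟨f', hf'⟩ := hD.exists_isApproxSeq hv
  exact tendsto_nhds_unique (Classical.epsilon_spec (p := fun c : ℝ => ∀ f g,
    D.IsApproxSeq f u → D.IsApproxSeq g v → Tendsto (fun n => D.energy (f n) (g n)) atTop (𝓝 c))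
    ⟨_, key⟩ f f' hf hf') (key f f' hf hf')

end IsEnergyForm

/-! ## Harmonic parts -/

/-- A larger set imposes weaker boundary conditions. With `B = univ` this is the inclusion of the
extended spaces. -/
theorem FiniteEnergy.mono {A B : Set ℝ} {u : ℝ → ℝ} (hu : FiniteEnergy A u) (h : A ⊆ B) :
    FiniteEnergy B u where
  exists_density :=
    let ⟨g, hg⟩ := hu.exists_density
    ⟨g, hg.mono h⟩
  zero_atTop h' := hu.zero_atTop ((measure_mono (inter_subset_inter_left _ h)).trans_lt h')
  zero_atBot h' := hu.zero_atBot ((measure_mono (inter_subset_inter_left _ h)).trans_lt h')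

/-- The density of a function that vanishes on a set without isolated points vanishes almost
everywhere on this set. -/
theorem HasL2Density.ae_eq_zero_of_preperfect {A F : Set ℝ} {u : ℝ → ℝ}
    {g : Lp ℝ 2 (volume : Measure ℝ)} (hF : Preperfect F) (hu : HasL2Density A u g)
    (h : ∀ x ∈ F, u x = 0) : ∀ᵐ x, x ∈ F → g x = 0 := by
  filter_upwards [hu.ae_hasDerivAt] with x hx hxF
  -- As `x` is not isolated in `F`, the slope can be computed along `F`, where it is zero.
  have : NeBot (𝓝[≠] x ⊓ 𝓟 F) := hF x hxF
  have h1 := (hasDerivAt_iff_tendsto_slope.1 hx).mono_left (inf_le_left : 𝓝[≠] x ⊓ 𝓟 F ≤ _)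
  refine tendsto_nhds_unique h1 (tendsto_const_nhds.congr' ?_)
  filter_upwards [mem_inf_of_right (mem_principal_self F)] with y hy
  rw [slope_def_field, h x hxF, h y hy, sub_zero, zero_div]

theorem HasL2Density.compl_of_preperfect {A F : Set ℝ} {u : ℝ → ℝ}
    {g : Lp ℝ 2 (volume : Measure ℝ)} (hF : Preperfect F) (hu : HasL2Density A u g)
    (h : ∀ x ∈ F, u x = 0) : HasL2Density Fᶜ u g where
  ae_eq_zero := by
    filter_upwards [hu.ae_eq_zero_of_preperfect hF h] with x hx hxF using hx (not_not.1 hxF)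
  sub_eq := hu.sub_eq

/-- The densities, vanishing almost everywhere on `F`, of the functions that vanish on `F`. -/
def vanishingDensities (F : Set ℝ) : Submodule ℝ (Lp ℝ 2 (volume : Measure ℝ)) where
  carrier := {k | ∃ w, HasL2Density Fᶜ w k ∧ ∀ x ∈ F, w x = 0}
  zero_mem' := ⟨0, HasL2Density.zero, fun _ _ => rfl⟩
  add_mem' := by
    rintro k k' ⟨w, hw, h⟩ ⟨w', hw', h'⟩
    exact ⟨w + w', hw.add hw', fun x hx => by simp [h x hx, h' x hx]⟩
  smul_mem' := by
    rintro c k ⟨w, hw, h⟩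
    exact ⟨c • w, hw.smul c, fun x hx => by simp [h x hx]⟩

/-- A point of `F`, where all the functions vanish, fixes the constant of integration of the limit.
-/
theorem isClosed_vanishingDensities {F : Set ℝ} (hF : F.Nonempty) :
    IsClosed (vanishingDensities F : Set (Lp ℝ 2 (volume : Measure ℝ))) := by
  obtain ⟨x₀, hx₀⟩ := hF
  refine isClosed_of_closure_subset fun k hk => ?_
  obtain ⟨kn, hkn, hlim⟩ := mem_closure_iff_seq_limit.1 hk
  choose w hw hwF using hkn
  have hv := hasL2Density_integral
    (HasL2Density.ae_eq_zero_of_tendsto (fun n => (hw n).ae_eq_zero) hlim) x₀ 0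
  refine ⟨_, hv, fun x hx => ?_⟩
  have h1 := HasL2Density.tendsto_of_tendsto hw hv hlim (x₀ := x₀) (by simp [hwF _ x₀ hx₀]) x
  simp only [hwF _ x hx] at h1
  exact (tendsto_nhds_unique h1 tendsto_const_nhds)

/-- `h` has finite energy on `A` and its density `l` is orthogonal to the densities of the
functions that vanish on `F`. -/
structure IsHarmonicOff (A F : Set ℝ) (h : ℝ → ℝ) (l : Lp ℝ 2 (volume : Measure ℝ)) : Prop where
  finiteEnergy : FiniteEnergy A h
  density : HasL2Density A h l
  orthogonal : l ∈ (vanishingDensities F)ᗮ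

namespace IsHarmonicOff

variable {A B F : Set ℝ} {u v h h' : ℝ → ℝ} {g l l' : Lp ℝ 2 (volume : Measure ℝ)}

theorem mono (hh : IsHarmonicOff A F h l) (hAB : A ⊆ B) : IsHarmonicOff B F h l :=
  ⟨hh.finiteEnergy.mono hAB, hh.density.mono hAB, hh.orthogonal⟩

theorem add (hh : IsHarmonicOff A F h l) (hh' : IsHarmonicOff A F h' l') :
    IsHarmonicOff A F (h + h') (l + l') :=
  ⟨hh.finiteEnergy.add hh'.finiteEnergy, hh.density.add hh'.density,
    Submodule.add_mem _ hh.orthogonal hh'.orthogonal⟩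

theorem smul (hh : IsHarmonicOff A F h l) (c : ℝ) : IsHarmonicOff A F (c • h) (c • l) :=
  ⟨hh.finiteEnergy.smul c, hh.density.smul c, Submodule.smul_mem _ c hh.orthogonal⟩

theorem sub (hh : IsHarmonicOff A F h l) (hh' : IsHarmonicOff A F h' l') :
    IsHarmonicOff A F (h - h') (l - l') :=
  ⟨hh.finiteEnergy.sub hh'.finiteEnergy, hh.density.sub hh'.density,
    Submodule.sub_mem _ hh.orthogonal hh'.orthogonal⟩

/-- The density of the difference lies both in `vanishingDensities F` and in its orthogonal
complement, so the difference is a constant, which is zero on `F`. -/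
theorem eq_of_eqOn (hF : Preperfect F) (hFn : F.Nonempty) (hh : IsHarmonicOff A F h l)
    (hh' : IsHarmonicOff A F h' l') (heq : ∀ x ∈ F, h x = h' x) : h = h' := by
  have hz : ∀ x ∈ F, (h - h') x = 0 := fun x hx => sub_eq_zero.2 (heq x hx)
  have h1 := hh.sub hh'
  have h2 : l - l' ∈ vanishingDensities F := ⟨h - h', h1.density.compl_of_preperfect hF hz, hz⟩
  have h3 : l - l' = 0 := by
    rw [← inner_self_eq_zero (𝕜 := ℝ)]
    exact (Submodule.mem_orthogonal _ _).1 h1.orthogonal _ h2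
  have h4 := h1.density
  rw [h3] at h4
  obtain ⟨x₀, hx₀⟩ := hFn
  ext x
  have h5 := h4.eq_const x x₀
  rw [hz x₀ hx₀] at h5
  exact sub_eq_zero.1 h5

/-- The harmonic function with the same values on `F` minimizes the energy. -/
theorem norm_le (hF : Preperfect F) (hh : IsHarmonicOff A F h l) (hu : HasL2Density A u g)
    (heq : ∀ x ∈ F, h x = u x) : ‖l‖ ≤ ‖g‖ := by
  have hz : ∀ x ∈ F, (u - h) x = 0 := fun x hx => sub_eq_zero.2 (heq x hx).symm
  have h2 : g - l ∈ vanishingDensities F :=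
    ⟨u - h, (hu.sub hh.density).compl_of_preperfect hF hz, hz⟩
  have h3 := (Submodule.mem_orthogonal _ _).1 hh.orthogonal _ h2
  have h4 := norm_add_sq_eq_norm_sq_add_norm_sq_real h3
  rw [sub_add_cancel] at h4
  nlinarith [norm_nonneg l, norm_nonneg g, mul_self_nonneg ‖g - l‖]

end IsHarmonicOff

namespace IsEnergyForm

variable {A F : Set ℝ} {D : L2Form (volume : Measure ℝ)} {u v h w : ℝ → ℝ}
  {g k l : Lp ℝ 2 (volume : Measure ℝ)}

/-- Either `F` reaches arbitrarily far out, so that `w` returns to zero, or `A` contains a half line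
and there is no condition at that end. -/
theorem finiteEnergy_of_eqOn_zero (hD : IsEnergyForm A D) (hFA : Fᶜ ⊆ A)
    (hw : HasL2Density Fᶜ w k) (h : ∀ x ∈ F, w x = 0) : FiniteEnergy A w := by
  refine FiniteEnergy.of_frequently hD.measurableSet (hw.mono hFA) (fun hfin ε hε hev => ?_)
    fun hfin ε hε hev => ?_
  · obtain ⟨N, hN⟩ := eventually_atTop.1 hev
    refine hfin.ne (measure_mono_top (s₁ := Ioi (max N 0)) (fun x hx => ⟨hFA fun hxF => ?_, ?_⟩)
      Real.volume_Ioi)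
    · exact hN x ((le_max_left _ _).trans (le_of_lt hx)) (by simpa [h x hxF] using hε)
    · exact (le_max_right N 0).trans_lt hx
  · obtain ⟨N, hN⟩ := eventually_atBot.1 hev
    refine hfin.ne (measure_mono_top (s₁ := Iio (min N 0)) (fun x hx => ⟨hFA fun hxF => ?_, ?_⟩)
      Real.volume_Iio)
    · exact hN x ((le_of_lt hx).trans (min_le_left _ _)) (by simpa [h x hxF] using hε)
    · exact lt_of_lt_of_le hx (min_le_right N 0)

/-- Orthogonality to `partSpace` becomes orthogonality to `vanishingDensities F`, in which `A` no
longer appears; this makes harmonic parts comparable between the two forms. -/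
theorem isHarmonicPart_iff (hD : IsEnergyForm A D) (hF : Preperfect F) (hFA : Fᶜ ⊆ A)
    (hu : FiniteEnergy A u) :
    D.IsHarmonicPart F u h ↔ (∃ l, IsHarmonicOff A F h l) ∧ ∀ x ∈ F, h x = u x := by
  constructor
  · rintro ⟨⟨hh, horth⟩, -, heq⟩
    rw [hD.mem_extendedSpace_iff] at hh
    obtain ⟨l, hl⟩ := hh.exists_density
    refine ⟨⟨l, hh, hl, (Submodule.mem_orthogonal' _ _).2 ?_⟩,
      fun x hx => (sub_eq_zero.1 (heq x hx)).symm⟩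
    rintro k ⟨w, hw, hwF⟩
    have hwe := hD.finiteEnergy_of_eqOn_zero hFA hw hwF
    have h1 := horth w ⟨hD.mem_extendedSpace_iff.2 hwe, hwF⟩
    rw [hD.extendedEnergy_eq hh hwe hl (hw.mono hFA)] at h1
    linarith
  · rintro ⟨⟨l, hl⟩, heq⟩
    refine ⟨⟨hD.mem_extendedSpace_iff.2 hl.finiteEnergy, ?_⟩,
      hD.mem_extendedSpace_iff.2 (hu.sub hl.finiteEnergy),
      fun x hx => sub_eq_zero.2 (heq x hx).symm⟩
    rintro w ⟨hw, hwF⟩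
    rw [hD.mem_extendedSpace_iff] at hw
    obtain ⟨k, hk⟩ := hw.exists_density
    rw [hD.extendedEnergy_eq hl.finiteEnergy hw hl.density hk,
      (Submodule.mem_orthogonal' _ _).1 hl.orthogonal k ⟨w, hk.compl_of_preperfect hF hwF, hwF⟩,
      mul_zero]

/-- Projecting the density of `u` onto the closed subspace `vanishingDensities F` gives a `w`
vanishing on `F`; then `u - w` is harmonic. -/
theorem exists_isHarmonicOff (hD : IsEnergyForm A D) (hFA : Fᶜ ⊆ A)
    (hFn : F.Nonempty) (hu : FiniteEnergy A u) :
    ∃ h, (∃ l, IsHarmonicOff A F h l) ∧ ∀ x ∈ F, h x = u x := by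
  obtain ⟨g, hg⟩ := hu.exists_density
  have : CompleteSpace (vanishingDensities F) :=
    (isClosed_vanishingDensities hFn).completeSpace_coe
  obtain ⟨k, hk, l, hl, rfl⟩ := (vanishingDensities F).exists_add_mem_mem_orthogonal g
  obtain ⟨w, hw, hwF⟩ := hk
  have h1 := hg.sub (hw.mono hFA)
  rw [add_sub_cancel_left] at h1
  exact ⟨u - w, ⟨l, hu.sub (hD.finiteEnergy_of_eqOn_zero hFA hw hwF), h1, hl⟩,
    fun x hx => by simp [hwF x hx]⟩

theorem existsUnique_isHarmonicPart (hD : IsEnergyForm A D) (hF : Preperfect F) (hFA : Fᶜ ⊆ A)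
    (hFn : F.Nonempty) (hu : FiniteEnergy A u) : ∃! h, D.IsHarmonicPart F u h := by
  obtain ⟨h, hh⟩ := hD.exists_isHarmonicOff hFA hFn hu
  refine ⟨h, (hD.isHarmonicPart_iff hF hFA hu).2 hh, fun h' hh' => ?_⟩
  obtain ⟨⟨l', hl'⟩, heq'⟩ := (hD.isHarmonicPart_iff hF hFA hu).1 hh'
  obtain ⟨⟨l, hl⟩, heq⟩ := hh
  exact hl'.eq_of_eqOn hF hFn hl fun x hx => (heq' x hx).trans (heq x hx).symm

theorem isHarmonicPart_harmonicPart (hD : IsEnergyForm A D) (hF : Preperfect F) (hFA : Fᶜ ⊆ A)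
    (hFn : F.Nonempty) (hu : FiniteEnergy A u) : D.IsHarmonicPart F u (D.harmonicPart F u) :=
  Classical.epsilon_spec (p := fun h => D.IsHarmonicPart F u h)
    (hD.existsUnique_isHarmonicPart hF hFA hFn hu).exists

/-- The harmonic part does not depend on the set `A`. -/
theorem harmonicPart_eq {B : Set ℝ} {D' : L2Form (volume : Measure ℝ)} (hD : IsEnergyForm A D)
    (hD' : IsEnergyForm B D') (hF : Preperfect F) (hFA : Fᶜ ⊆ A) (hAB : A ⊆ B) (hFn : F.Nonempty)
    (hu : FiniteEnergy A u) : D'.harmonicPart F u = D.harmonicPart F u := by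
  refine (hD'.existsUnique_isHarmonicPart hF (hFA.trans hAB) hFn (hu.mono hAB)).unique
    (hD'.isHarmonicPart_harmonicPart hF (hFA.trans hAB) hFn (hu.mono hAB)) ?_
  obtain ⟨⟨l, hl⟩, heq⟩ := (hD.isHarmonicPart_iff hF hFA hu).1
    (hD.isHarmonicPart_harmonicPart hF hFA hFn hu)
  exact (hD'.isHarmonicPart_iff hF (hFA.trans hAB) (hu.mono hAB)).2 ⟨⟨l, hl.mono hAB⟩, heq⟩

end IsEnergyForm

/-! ## Traces -/

/-- `h` is harmonic off `F`, has density `l`, and equals `φ` almost everywhere on `F`. -/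
structure IsHarmonicExtension (A F : Set ℝ) (μ : Measure F) (φ : Lp ℝ 2 μ) (h : ℝ → ℝ)
    (l : Lp ℝ 2 (volume : Measure ℝ)) : Prop where
  isHarmonicOff : IsHarmonicOff A F h l
  ae_eq : φ =ᵐ[μ] fun x : F => h x

namespace IsHarmonicExtension

variable {A F : Set ℝ} {μ : Measure F} {φ ψ : Lp ℝ 2 μ} {h h' : ℝ → ℝ}
  {l l' : Lp ℝ 2 (volume : Measure ℝ)}

theorem add (hh : IsHarmonicExtension A F μ φ h l) (hh' : IsHarmonicExtension A F μ ψ h' l') :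
    IsHarmonicExtension A F μ (φ + ψ) (h + h') (l + l') where
  isHarmonicOff := hh.isHarmonicOff.add hh'.isHarmonicOff
  ae_eq := (Lp.coeFn_add φ ψ).trans (hh.ae_eq.add hh'.ae_eq)

theorem smul (hh : IsHarmonicExtension A F μ φ h l) (c : ℝ) :
    IsHarmonicExtension A F μ (c • φ) (c • h) (c • l) where
  isHarmonicOff := hh.isHarmonicOff.smul c
  ae_eq := (Lp.coeFn_smul c φ).trans (hh.ae_eq.const_smul c)

theorem sub (hh : IsHarmonicExtension A F μ φ h l) (hh' : IsHarmonicExtension A F μ ψ h' l') :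
    IsHarmonicExtension A F μ (φ - ψ) (h - h') (l - l') where
  isHarmonicOff := hh.isHarmonicOff.sub hh'.isHarmonicOff
  ae_eq := (Lp.coeFn_sub φ ψ).trans (hh.ae_eq.sub hh'.ae_eq)

end IsHarmonicExtension

/-- Full support of `μ` makes the values on `F` of a continuous extension unique, so the trace
energy does not depend on the extension. -/
theorem eqOn_of_ae_eq {F : Set ℝ} {μ : Measure F} [μ.IsOpenPosMeasure] {u v : ℝ → ℝ}
    (hu : Continuous u) (hv : Continuous v)
    (h : (fun x : F => u x) =ᵐ[μ] fun x : F => v x) : ∀ x ∈ F, u x = v x := by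
  have := ((hu.comp continuous_subtype_val).ae_eq_iff_eq μ (hv.comp continuous_subtype_val)).1 h
  exact fun x hx => congrFun this ⟨x, hx⟩

namespace IsEnergyForm

variable {A F : Set ℝ} {D : L2Form (volume : Measure ℝ)} {μ : Measure F} {φ ψ : Lp ℝ 2 μ}
  {u h h' : ℝ → ℝ} {g l l' : Lp ℝ 2 (volume : Measure ℝ)}

theorem mem_trace_domain (hD : IsEnergyForm A D) (hu : FiniteEnergy A u)
    (hφ : φ =ᵐ[μ] fun x : F => u x) : φ ∈ (D.trace F μ).domain :=
  ⟨u, hD.mem_extendedSpace_iff.2 hu, hφ⟩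

theorem exists_isHarmonicExtension (hD : IsEnergyForm A D) (hFA : Fᶜ ⊆ A) (hFn : F.Nonempty)
    (hφ : φ ∈ (D.trace F μ).domain) : ∃ h l, IsHarmonicExtension A F μ φ h l := by
  obtain ⟨u, hu, hφu⟩ := hφ
  obtain ⟨h, ⟨l, hl⟩, heq⟩ := hD.exists_isHarmonicOff hFA hFn (hD.mem_extendedSpace_iff.1 hu)
  refine ⟨h, l, hl, hφu.trans (Eventually.of_forall fun x => ?_)⟩
  exact (heq x x.2).symm

theorem trace_energy_eq [μ.IsOpenPosMeasure] (hD : IsEnergyForm A D) (hF : Preperfect F)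
    (hFA : Fᶜ ⊆ A) (hFn : F.Nonempty) (hh : IsHarmonicExtension A F μ φ h l)
    (hh' : IsHarmonicExtension A F μ ψ h' l') :
    (D.trace F μ).energy φ ψ = 1 / 2 * inner ℝ l l' := by
  -- The chosen extension need not be `h`, but it agrees with `h` on `F` and so has `h` as its
  -- harmonic part.
  have key : ∀ {φ : Lp ℝ 2 μ} {h l}, IsHarmonicExtension A F μ φ h l →
      D.harmonicPart F (Classical.epsilon fun u => D.IsExtension F μ φ u) = h := by
    intro φ h l hh
    have hex := Classical.epsilon_spec (p := fun u => D.IsExtension F μ φ u)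
      ⟨h, hD.mem_extendedSpace_iff.2 hh.isHarmonicOff.finiteEnergy, hh.ae_eq⟩
    set u := Classical.epsilon fun u => D.IsExtension F μ φ u
    have hu := hD.mem_extendedSpace_iff.1 hex.1
    refine (hD.existsUnique_isHarmonicPart hF hFA hFn hu).unique
      (hD.isHarmonicPart_harmonicPart hF hFA hFn hu)
      ((hD.isHarmonicPart_iff hF hFA hu).2 ⟨⟨l, hh.isHarmonicOff⟩, ?_⟩)
    exact eqOn_of_ae_eq hh.isHarmonicOff.finiteEnergy.continuous hu.continuous
      (hh.ae_eq.symm.trans hex.2)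
  change D.extendedEnergy (D.harmonicPart F (Classical.epsilon fun u => D.IsExtension F μ φ u))
    (D.harmonicPart F (Classical.epsilon fun v => D.IsExtension F μ ψ v)) = _
  rw [key hh, key hh']
  exact hD.extendedEnergy_eq hh.isHarmonicOff.finiteEnergy hh'.isHarmonicOff.finiteEnergy
    hh.isHarmonicOff.density hh'.isHarmonicOff.density

theorem trace_energy_self [μ.IsOpenPosMeasure] (hD : IsEnergyForm A D) (hF : Preperfect F)
    (hFA : Fᶜ ⊆ A) (hFn : F.Nonempty) (hh : IsHarmonicExtension A F μ φ h l) :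
    (D.trace F μ).energy φ φ = 1 / 2 * ‖l‖ ^ 2 := by
  rw [hD.trace_energy_eq hF hFA hFn hh hh, real_inner_self_eq_norm_sq]

/-- The trace energy is at most the energy of any extension. -/
theorem trace_energy_le [μ.IsOpenPosMeasure] (hD : IsEnergyForm A D) (hF : Preperfect F)
    (hFA : Fᶜ ⊆ A) (hFn : F.Nonempty) (hu : FiniteEnergy A u) (hg : HasL2Density A u g)
    (hφ : φ =ᵐ[μ] fun x : F => u x) : (D.trace F μ).energy φ φ ≤ 1 / 2 * ‖g‖ ^ 2 := by
  obtain ⟨h, l, hh⟩ := hD.exists_isHarmonicExtension hFA hFn (hD.mem_trace_domain hu hφ)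
  rw [hD.trace_energy_self hF hFA hFn hh]
  have := hh.isHarmonicOff.norm_le hF hg (eqOn_of_ae_eq hh.isHarmonicOff.finiteEnergy.continuous
    hu.continuous (hh.ae_eq.symm.trans hφ))
  gcongr

end IsEnergyForm

/-! ## Uniform approximation by functions of finite energy -/

/-- On a compact set, a strictly increasing continuous function increases by a definite amount over
a fixed length. -/
theorem StrictMono.exists_pos_le_abs_sub {S : ℝ → ℝ} (hS : StrictMono S) (hSc : Continuous S)
    (R : ℝ) {δ : ℝ} (hδ : 0 < δ) :
    ∃ m > 0, ∀ x y, |y| ≤ R → δ ≤ |x - y| → m ≤ |S x - S y| := by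
  rcases lt_or_ge R 0 with hR | hR
  · exact ⟨1, one_pos, fun x y hy => absurd (abs_nonneg y) (by linarith)⟩
  -- The smaller of the two increments over length `δ` attains a positive minimum on `[-R, R]`;
  -- monotonicity then covers every `x` at distance at least `δ` from `y`.
  obtain ⟨z₀, -, hz₀⟩ := (isCompact_Icc (a := -R) (b := R)).exists_isMinOn
    (nonempty_Icc.2 (by linarith)) (f := fun z => min (S (z + δ) - S z) (S z - S (z - δ)))
    (by fun_prop)
  refine ⟨min (S (z₀ + δ) - S z₀) (S z₀ - S (z₀ - δ)), lt_min (sub_pos.2 (hS (by linarith)))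
    (sub_pos.2 (hS (by linarith))), fun x y hy hxy => (hz₀ (abs_le.1 hy)).trans ?_⟩
  rcases le_abs'.1 hxy with h | h
  · have h1 : S x ≤ S (y - δ) := hS.monotone (by linarith)
    rw [abs_sub_comm]
    exact (min_le_right _ _).trans ((by linarith : S y - S (y - δ) ≤ S y - S x).trans
      (le_abs_self _))
  · have h1 : S (y + δ) ≤ S x := hS.monotone (by linarith)
    exact (min_le_left _ _).trans ((by linarith : S (y + δ) - S y ≤ S x - S y).trans
      (le_abs_self _))

/-- A sup-convolution of `f` with the cone `L * |S x - S y|` is Lipschitz with respect to `S`, hence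
its derivative is carried by `A`. -/
theorem exists_finiteEnergy_near_of_nonneg {A F : Set ℝ} (hA : MeasurableSet A)
    (hpos : ∀ a b, a < b → 0 < volume (A ∩ Ioo a b)) [Nonempty F] {f : F → ℝ}
    (hf : Continuous f) (hfs : HasCompactSupport f) (hf0 : ∀ x, 0 ≤ f x) {ε : ℝ} (hε : 0 < ε) :
    ∃ u, FiniteEnergy A u ∧ HasCompactSupport u ∧
      ∀ x : F, |f x - u x| < ε ∧ (f x = 0 → u x = 0) := by
  set S := indicatorPrimitive A
  obtain ⟨δ, hδ, hfδ⟩ := Metric.uniformContinuous_iff.1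
    (hfs.uniformContinuous_of_continuous hf) (ε / 2) (half_pos hε)
  obtain ⟨R, hR⟩ : ∃ R, ∀ y : F, f y ≠ 0 → |(y : ℝ)| ≤ R := by
    obtain ⟨R, hR⟩ := ((hfs.isCompact.image continuous_subtype_val).isBounded).exists_norm_le
    exact ⟨R, fun y hy => hR y ⟨y, subset_tsupport f hy, rfl⟩⟩
  obtain ⟨C, hC⟩ := hf.bounded_above_of_compact_support hfs
  have hC' : ∀ y, f y ≤ C := fun y => (le_abs_self _).trans (hC y)
  have hC0 : 0 ≤ C := (norm_nonneg _).trans (hC (Classical.arbitrary F))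
  obtain ⟨m, hm, hSm⟩ := (indicatorPrimitive_strictMono hA hpos).exists_pos_le_abs_sub
    (continuous_indicatorPrimitive hA) R hδ
  -- Steep enough that points of `F` at distance at least `δ` contribute nothing, since there `L *
  -- |S x - S y|` exceeds the bound `C` of `f`.
  set L := C / m with hL
  have hL0 : 0 ≤ L := div_nonneg hC0 hm.le
  set q : ℝ → F → ℝ := fun x y => max 0 (f y - L * |S x - S y|) with hq
  have hqC : ∀ x y, q x y ≤ C := fun x y =>
    max_le hC0 ((sub_le_self _ (by positivity)).trans (hC' y))
  have hbdd : ∀ x, BddAbove (range (q x)) := fun x => ⟨C, by rintro _ ⟨y, rfl⟩; exact hqC x y⟩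
  have hfar : ∀ x (y : F), δ ≤ |x - (y : ℝ)| → q x y = 0 := fun x y hxy => by
    refine max_eq_left ?_
    by_cases hy : f y = 0
    · rw [hy]
      have : 0 ≤ L * |S x - S y| := by positivity
      linarith
    · have h1 : L * m ≤ L * |S x - S y| := by
        gcongr
        exact hSm x y (hR y hy) hxy
      rw [hL, div_mul_cancel₀ _ hm.ne'] at h1
      linarith [hC' y]
  set p : ℝ → ℝ := fun x => ⨆ y, q x y with hp
  have hp_lip : ∀ x x', p x' ≤ p x + L * |S x' - S x| := fun x x' => by
    refine ciSup_le fun y => ?_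
    have h1 : q x' y ≤ q x y + L * |S x' - S x| := by
      have h2 : |S x - S y| ≤ |S x' - S x| + |S x' - S y| := by
        rw [abs_sub_comm (S x') (S x)]
        exact abs_sub_le _ _ _
      have h3 := mul_le_mul_of_nonneg_left h2 hL0
      have h4 : 0 ≤ L * |S x' - S x| := by positivity
      rcases max_cases 0 (f y - L * |S x' - S y|) with h | h
      · simp only [hq, h.1]
        linarith [le_max_left 0 (f y - L * |S x - S y|)]
      · simp only [hq, h.1]
        linarith [le_max_right 0 (f y - L * |S x - S y|)]
    exact h1.trans (by linarith [le_ciSup (hbdd x) y])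
  have hp_lip' : ∀ x y, |p y - p x| ≤ L * |S y - S x| := fun x y => abs_le.2
    ⟨by linarith [abs_sub_comm (S y) (S x) ▸ hp_lip y x], by linarith [hp_lip x y]⟩
  have hp_ge : ∀ x : F, f x ≤ p x := fun x => by
    refine le_trans ?_ (le_ciSup (hbdd x) x)
    simp only [hq, sub_self, abs_zero, mul_zero, sub_zero]
    exact le_max_right _ _
  have hp_le : ∀ x : F, p x ≤ f x + ε / 2 := fun x => ciSup_le fun y => by
    rcases lt_or_ge |(x : ℝ) - y| δ with h | h
    · have h1 := hfδ (show dist x y < δ from h)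
      rw [Real.dist_eq] at h1
      refine max_le (by linarith [hf0 x]) ?_
      have : 0 ≤ L * |S x - S y| := by positivity
      linarith [(abs_lt.1 h1).1]
    · rw [hfar x y h]
      linarith [hf0 x]
  -- Lowering by `ε / 2`, the possible excess of `p` over `f` on `F`, makes `u` vanish wherever `f`
  -- does.
  set u : ℝ → ℝ := fun x => max 0 (p x - ε / 2) with hu
  have hu_lip : ∀ x y, |u y - u x| ≤ L * |S y - S x| := fun x y => by
    refine (abs_max_sub_max_le_max _ _ _ _).trans ?_
    rw [sub_self, abs_zero, max_eq_right (abs_nonneg _), sub_sub_sub_cancel_right]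
    exact hp_lip' x y
  have hus : HasCompactSupport u := by
    refine HasCompactSupport.of_support_subset_isCompact
      (isCompact_Icc (a := -(R + δ)) (b := R + δ)) fun x hx => abs_le.1 ?_
    by_contra h
    refine hx ?_
    have h1 : p x ≤ 0 := ciSup_le fun y => by
      by_cases hy : f y = 0
      · refine (max_eq_left ?_).le
        rw [hy]
        have : 0 ≤ L * |S x - S y| := by positivity
        linarith
      · refine (hfar x y ?_).le
        have := abs_sub_abs_le_abs_sub x (y : ℝ)
        linarith [hR y hy, not_le.1 h]
    exact max_eq_left (by linarith)
  refine ⟨u, FiniteEnergy.of_abs_sub_le_indicatorPrimitive hA hus hu_lip, hus, fun x =>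
    ⟨?_, fun hx => max_eq_left (by linarith [hp_le x])⟩⟩
  have h1 : u x ≤ f x := max_le (hf0 x) (by linarith [hp_le x])
  have h2 : p x - ε / 2 ≤ u x := le_max_right _ _
  rw [abs_of_nonneg (by linarith)]
  linarith [hp_ge x]

/-- Compactly supported continuous functions on `F` are uniform limits of functions of finite
energy on `A`. -/
theorem exists_finiteEnergy_near {A F : Set ℝ} (hA : MeasurableSet A)
    (hpos : ∀ a b, a < b → 0 < volume (A ∩ Ioo a b)) [Nonempty F] {f : F → ℝ}
    (hf : Continuous f) (hfs : HasCompactSupport f) {ε : ℝ} (hε : 0 < ε) :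
    ∃ u, FiniteEnergy A u ∧ HasCompactSupport u ∧
      ∀ x : F, |f x - u x| < ε ∧ (f x = 0 → u x = 0) := by
  obtain ⟨u, hu, hus, huf⟩ := exists_finiteEnergy_near_of_nonneg hA hpos
    (f := fun x => max (f x) 0) (by fun_prop) (hfs.comp_left (g := fun t => max t 0) (by simp))
    (fun x => le_max_right _ _) (half_pos hε)
  obtain ⟨v, hv, hvs, hvf⟩ := exists_finiteEnergy_near_of_nonneg hA hpos
    (f := fun x => max (-f x) 0) (by fun_prop) (hfs.comp_left (g := fun t => max (-t) 0) (by simp))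
    (fun x => le_max_right _ _) (half_pos hε)
  refine ⟨u - v, hu.sub hv, hus.sub hvs, fun x => ⟨?_, fun hx => ?_⟩⟩
  · have h1 := abs_lt.1 (huf x).1
    have h2 := abs_lt.1 (hvf x).1
    have h3 : max (f x) 0 - max (-f x) 0 = f x :=
      max_zero_sub_max_neg_zero_eq_self (f x)
    rw [Pi.sub_apply, abs_lt]
    constructor <;> linarith
  · rw [Pi.sub_apply, (huf x).2 (by simp [hx]), (hvf x).2 (by simp [hx]), sub_zero]

/-! ## The trace is a regular Dirichlet form -/

/-- Multiplication by cutoffs that are eventually one at each point converges in `L²`. -/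
theorem tendsto_norm_sub_of_cutoff {X : Type*} [MeasurableSpace X] {μ : Measure X} {φ : Lp ℝ 2 μ}
    {ψ : ℕ → Lp ℝ 2 μ} {χ : ℕ → X → ℝ} (hψ : ∀ n, ψ n =ᵐ[μ] fun x => φ x * χ n x)
    (hχ : ∀ n x, χ n x ∈ Icc (0 : ℝ) 1) (hlim : ∀ x, ∀ᶠ n in atTop, χ n x = 1) :
    Tendsto (fun n => ‖φ - ψ n‖) atTop (𝓝 0) := by
  have h1 : Tendsto (fun n => ∫ x, (φ - ψ n) x ^ 2 ∂μ) atTop (𝓝 (∫ _, (0 : ℝ) ∂μ)) := by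
    refine tendsto_integral_of_dominated_convergence (fun x => φ x ^ 2)
      (fun n => ((Lp.memLp (φ - ψ n)).integrable_sq).1) (Lp.memLp φ).integrable_sq (fun n => ?_) ?_
    · filter_upwards [Lp.coeFn_sub φ (ψ n), hψ n] with x h1 h2
      rw [h1, Pi.sub_apply, h2, Real.norm_eq_abs, abs_of_nonneg (sq_nonneg _),
        show φ x - φ x * χ n x = φ x * (1 - χ n x) by ring, mul_pow]
      refine mul_le_of_le_one_right (sq_nonneg _) (pow_le_one₀ ?_ ?_) <;>
        linarith [(hχ n x).1, (hχ n x).2]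
    · filter_upwards [ae_all_iff.2 fun n => Lp.coeFn_sub φ (ψ n), ae_all_iff.2 hψ] with x h1 h2
      refine tendsto_const_nhds.congr' ?_
      filter_upwards [hlim x] with n hn
      rw [h1, Pi.sub_apply, h2, hn, mul_one, sub_self, zero_pow two_ne_zero]
  have h2 : ∀ n, ∫ x, (φ - ψ n) x ^ 2 ∂μ = ‖φ - ψ n‖ ^ 2 := fun n => by
    rw [← real_inner_self_eq_norm_sq, L2.inner_def]
    simp only [real_inner_self_eq_norm_sq, Real.norm_eq_abs, sq_abs]
  simp only [h2, integral_zero] at h1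
  simpa using h1.sqrt

namespace IsEnergyForm

variable {A F : Set ℝ} {D : L2Form (volume : Measure ℝ)} {μ : Measure F}

theorem memLp_restrict [IsLocallyFiniteMeasure μ] (hFc : IsClosed F) {u : ℝ → ℝ}
    (hu : Continuous u) (hus : HasCompactSupport u) : MemLp (fun x : F => u x) 2 μ :=
  (hu.comp continuous_subtype_val).memLp_of_hasCompactSupport
    (hus.comp_isClosedEmbedding hFc.isClosedEmbedding_subtypeVal)

/-- An energy-Cauchy sequence in the trace has convergent harmonic densities, and the orthogonal
complement is closed, so the limit density belongs to a harmonic extension of the L² limit. -/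
theorem trace_closed [μ.IsOpenPosMeasure] (hD : IsEnergyForm A D)
    (hF : Preperfect F) (hFA : Fᶜ ⊆ A) (hFn : F.Nonempty) (φ : ℕ → Lp ℝ 2 μ)
    (hφ : ∀ n, φ n ∈ (D.trace F μ).domain)
    (hcau : Tendsto (fun p : ℕ × ℕ => (D.trace F μ).energyOne (φ p.1 - φ p.2)) atTop (𝓝 0)) :
    ∃ ψ ∈ (D.trace F μ).domain,
      Tendsto (fun n => (D.trace F μ).energyOne (φ n - ψ)) atTop (𝓝 0) := by
  choose h l hh using fun n => hD.exists_isHarmonicExtension hFA hFn (hφ n)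
  have hen : ∀ p : ℕ × ℕ, (D.trace F μ).energyOne (φ p.1 - φ p.2) =
      1 / 2 * ‖l p.1 - l p.2‖ ^ 2 + ‖φ p.1 - φ p.2‖ ^ 2 := fun p => by
    rw [L2Form.energyOne, hD.trace_energy_self hF hFA hFn ((hh p.1).sub (hh p.2))]
  simp only [hen] at hcau
  have hl_cau : CauchySeq l := tendsto_half_norm_sub_sq_iff_cauchySeq.1 <|
    squeeze_zero (fun p => by positivity) (fun p => by linarith [sq_nonneg ‖φ p.1 - φ p.2‖]) hcau
  have hφ_cau : CauchySeq φ := tendsto_half_norm_sub_sq_iff_cauchySeq.1 <|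
    squeeze_zero (fun p => by positivity)
      (fun p => by linarith [sq_nonneg ‖φ p.1 - φ p.2‖, sq_nonneg ‖l p.1 - l p.2‖]) hcau
  obtain ⟨k, hk⟩ := cauchySeq_tendsto_of_complete hl_cau
  obtain ⟨ψ, hψ⟩ := cauchySeq_tendsto_of_complete hφ_cau
  -- The subsequence serves only to identify `ψ` with the limit function on `F`; the energies
  -- converge along the full sequence.
  obtain ⟨ns, hns, hlim⟩ := (tendstoInMeasure_of_tendsto_Lp hψ).exists_seq_tendsto_ae
  have hlim' : ∀ᵐ x : F ∂μ, Tendsto (fun n => h (ns n) x) atTop (𝓝 (ψ x)) := by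
    filter_upwards [hlim, ae_all_iff.2 fun n => (hh n).ae_eq] with x h1 h2
    simpa only [h2] using h1
  have : Nonempty F := hFn.to_subtype
  obtain ⟨x₀, hx₀⟩ := hlim'.exists
  have hks := hk.comp hns.tendsto_atTop
  have hdens := fun n => (hh (ns n)).isHarmonicOff.density
  have hv := hasL2Density_integral
    (HasL2Density.ae_eq_zero_of_tendsto (fun n => (hdens n).ae_eq_zero) hks) x₀ (ψ x₀)
  set v : ℝ → ℝ := fun x => ψ x₀ + ∫ t in (x₀ : ℝ)..x, k t
  have hx₀' : Tendsto (fun n => h (ns n) x₀) atTop (𝓝 (v x₀)) := by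
    simpa [v] using hx₀
  have hext : IsHarmonicExtension A F μ ψ v k := by
    refine ⟨⟨?_, hv, ?_⟩, ?_⟩
    · exact FiniteEnergy.of_tendsto hD.measurableSet
        (fun n => (hh (ns n)).isHarmonicOff.finiteEnergy) hdens hv hks hx₀'
    · exact (Submodule.isClosed_orthogonal _).mem_of_tendsto hk
        (Eventually.of_forall fun n => (hh n).isHarmonicOff.orthogonal)
    · filter_upwards [hlim'] with x hx
      exact tendsto_nhds_unique hx (HasL2Density.tendsto_of_tendsto hdens hv hks hx₀' x)
  refine ⟨ψ, hD.mem_trace_domain hext.isHarmonicOff.finiteEnergy hext.ae_eq, ?_⟩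
  have hen' : ∀ n, (D.trace F μ).energyOne (φ n - ψ) =
      1 / 2 * ‖l n - k‖ ^ 2 + ‖φ n - ψ‖ ^ 2 := fun n => by
    rw [L2Form.energyOne, hD.trace_energy_self hF hFA hFn ((hh n).sub hext)]
  simp only [hen']
  simpa only [zero_pow two_ne_zero, mul_zero, add_zero] using (((tendsto_iff_norm_sub_tendsto_zero.1 hk).pow 2).const_mul (1 / 2)).add
    ((tendsto_iff_norm_sub_tendsto_zero.1 hψ).pow 2)

theorem trace_dense [IsLocallyFiniteMeasure μ] (hD : IsEnergyForm A D) (hFc : IsClosed F)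
    (hFn : F.Nonempty) : Dense (D.trace F μ).domain := by
  have : Nonempty F := hFn.to_subtype
  have : LocallyCompactSpace F := hFc.locallyCompactSpace
  have : SigmaCompactSpace F := hFc.sigmaCompactSpace
  refine fun φ => Metric.mem_closure_iff.2 fun ε hε => ?_
  obtain ⟨f, hfs, hfφ, hf, hfL⟩ := (Lp.memLp φ).exists_hasCompactSupport_eLpNorm_sub_le
    ENNReal.ofNat_ne_top (ENNReal.ofReal_pos.2 (half_pos hε)).ne'
  have hS : MeasurableSet (tsupport f) := hfs.isCompact.measurableSet
  have hS' : μ (tsupport f) ≠ ⊤ := hfs.isCompact.measure_lt_top.ne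
  -- An error of `c` on the support of `f` has L² norm below `ε / 2`; the added 1 avoids division by
  -- zero.
  set c := ε / 2 / (1 + √(μ.real (tsupport f))) with hc
  have hc0 : 0 < c := by positivity
  obtain ⟨u, hu, hus, huf⟩ := exists_finiteEnergy_near hD.measurableSet hD.pos hf hfs hc0
  have huL := memLp_restrict (μ := μ) hFc hu.continuous hus
  refine ⟨huL.toLp _, hD.mem_trace_domain hu huL.coeFn_toLp, ?_⟩
  have h1 : ‖φ - hfL.toLp f‖ ≤ ε / 2 := by
    rw [Lp.norm_def, eLpNorm_congr_ae ((Lp.coeFn_sub _ _).trans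
      ((ae_eq_refl _).sub hfL.coeFn_toLp))]
    exact ENNReal.toReal_le_of_le_ofReal (by positivity) hfφ
  have h2 : ‖hfL.toLp f - huL.toLp _‖ ≤ ‖indicatorConstLp 2 hS hS' c‖ := by
    refine Lp.norm_le_norm_of_ae_le ?_
    filter_upwards [Lp.coeFn_sub (hfL.toLp f) (huL.toLp _), hfL.coeFn_toLp, huL.coeFn_toLp,
      indicatorConstLp_coeFn (μ := μ) (p := 2) (hs := hS) (hμs := hS') (c := c)] with x h1 h2 h3 h4
    rw [h1, Pi.sub_apply, h2, h3, h4]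
    by_cases hx : x ∈ tsupport f
    · rw [indicator_of_mem hx, Real.norm_eq_abs, Real.norm_eq_abs, abs_of_pos hc0]
      exact (huf x).1.le
    · have hfx : f x = 0 := image_eq_zero_of_notMem_tsupport hx
      rw [hfx, (huf x).2 hfx, sub_zero, norm_zero]
      exact norm_nonneg _
  have h3 : ‖indicatorConstLp 2 hS hS' c‖ < ε / 2 := by
    rw [norm_indicatorConstLp (by norm_num) (by norm_num), ENNReal.toReal_ofNat,
      ← Real.sqrt_eq_rpow, Real.norm_eq_abs, abs_of_pos hc0, hc, div_mul_eq_mul_div,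
      div_lt_iff₀ (by positivity)]
    exact mul_lt_mul_of_pos_left (by linarith) (by positivity)
  calc dist φ (huL.toLp _) ≤ dist φ (hfL.toLp f) + dist (hfL.toLp f) (huL.toLp _) :=
        dist_triangle _ _ _
    _ < ε / 2 + ε / 2 := by
        rw [dist_eq_norm, dist_eq_norm]
        exact add_lt_add_of_le_of_lt h1 (h2.trans_lt h3)
    _ = ε := add_halves ε

/-- The harmonic extension is cut off. The result need not be harmonic, but `trace_energy_le` bounds
the trace energy of the difference by the change of density. -/
theorem trace_dense_domain [μ.IsOpenPosMeasure] [IsLocallyFiniteMeasure μ]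
    (hD : IsEnergyForm A D) (hFc : IsClosed F) (hF : Preperfect F) (hFA : Fᶜ ⊆ A)
    (hFn : F.Nonempty) {φ : Lp ℝ 2 μ} (hφ : φ ∈ (D.trace F μ).domain) {ε : ℝ} (hε : 0 < ε) :
    ∃ f : F → ℝ, Continuous f ∧ HasCompactSupport f ∧
      ∃ w ∈ (D.trace F μ).domain, w =ᵐ[μ] f ∧ (D.trace F μ).energyOne (φ - w) < ε := by
  obtain ⟨h, l, hh⟩ := hD.exists_isHarmonicExtension hFA hFn hφ
  have hfe := hh.isHarmonicOff.finiteEnergy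
  choose χ hχc hχs hχ hχ1 k hk hkl using fun n : ℕ =>
    hfe.exists_cutoff hD.measurableSet hD.pos hh.isHarmonicOff.density n
      (Nat.one_div_pos_of_nat (α := ℝ) (n := n))
  have hcont : ∀ n, Continuous (h * χ n) := fun n => hfe.continuous.mul (hχc n)
  have hsupp : ∀ n, HasCompactSupport (h * χ n) := fun n => (hχs n).mul_left
  have hmem := fun n => memLp_restrict (μ := μ) hFc (hcont n) (hsupp n)
  have hfe' := fun n => FiniteEnergy.of_hasCompactSupport (hk n) (hsupp n)
  have hL2 : Tendsto (fun n => ‖φ - (hmem n).toLp _‖) atTop (𝓝 0) := by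
    refine tendsto_norm_sub_of_cutoff (χ := fun n x => χ n x) (fun n => ?_) (fun n x => hχ n x)
      fun x => ?_
    · filter_upwards [(hmem n).coeFn_toLp, hh.ae_eq] with x h1 h2
      rw [h1, h2, Pi.mul_apply]
    · obtain ⟨N, hN⟩ := exists_nat_ge |(x : ℝ)|
      filter_upwards [eventually_ge_atTop N] with n hn
      exact hχ1 n x (abs_le.1 (hN.trans (by exact_mod_cast hn)))
  have hen : Tendsto (fun n : ℕ => 1 / 2 * (1 / ((n : ℝ) + 1)) ^ 2 + ‖φ - (hmem n).toLp _‖ ^ 2)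
      atTop (𝓝 0) := by
    have := ((tendsto_one_div_add_atTop_nhds_zero_nat (𝕜 := ℝ)).pow 2).const_mul (1 / 2)
    simpa only [zero_pow two_ne_zero, mul_zero, add_zero] using this.add (hL2.pow 2)
  obtain ⟨n, hn⟩ := (hen.eventually_lt_const hε).exists
  refine ⟨fun x => (h * χ n) x, (hcont n).comp continuous_subtype_val,
    (hsupp n).comp_isClosedEmbedding hFc.isClosedEmbedding_subtypeVal, (hmem n).toLp _,
    hD.mem_trace_domain (hfe' n) (hmem n).coeFn_toLp, (hmem n).coeFn_toLp, lt_of_le_of_lt ?_ hn⟩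
  have h1 := hD.trace_energy_le hF hFA hFn (hfe.sub (hfe' n))
    (hh.isHarmonicOff.density.sub (hk n)) ((Lp.coeFn_sub _ _).trans
      (hh.ae_eq.sub (hmem n).coeFn_toLp))
  have h2 : ‖l - k n‖ ≤ 1 / ((n : ℝ) + 1) := by
    rw [norm_sub_rev]
    exact hkl n
  refine add_le_add (h1.trans ?_) le_rfl
  gcongr

/-- The trace on `F` is a regular Dirichlet form. -/
theorem isRegularDirichletForm_trace [μ.IsOpenPosMeasure] [IsLocallyFiniteMeasure μ]
    (hD : IsEnergyForm A D) (hFc : IsClosed F) (hF : Preperfect F) (hFA : Fᶜ ⊆ A)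
    (hFn : F.Nonempty) : (D.trace F μ).IsRegularDirichletForm where
  zero_mem := hD.mem_trace_domain FiniteEnergy.zero (Lp.coeFn_zero _ _ _)
  add_mem φ hφ ψ hψ := by
    obtain ⟨h, l, hh⟩ := hD.exists_isHarmonicExtension hFA hFn hφ
    obtain ⟨h', l', hh'⟩ := hD.exists_isHarmonicExtension hFA hFn hψ
    exact hD.mem_trace_domain (hh.add hh').isHarmonicOff.finiteEnergy (hh.add hh').ae_eq
  smul_mem c φ hφ := by
    obtain ⟨h, l, hh⟩ := hD.exists_isHarmonicExtension hFA hFn hφ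
    exact hD.mem_trace_domain (hh.smul c).isHarmonicOff.finiteEnergy (hh.smul c).ae_eq
  dense := hD.trace_dense hFc hFn
  add_left φ hφ ψ hψ χ hχ := by
    obtain ⟨h₁, l₁, hh₁⟩ := hD.exists_isHarmonicExtension hFA hFn hφ
    obtain ⟨h₂, l₂, hh₂⟩ := hD.exists_isHarmonicExtension hFA hFn hψ
    obtain ⟨h₃, l₃, hh₃⟩ := hD.exists_isHarmonicExtension hFA hFn hχ
    rw [hD.trace_energy_eq hF hFA hFn (hh₁.add hh₂) hh₃, hD.trace_energy_eq hF hFA hFn hh₁ hh₃,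
      hD.trace_energy_eq hF hFA hFn hh₂ hh₃, inner_add_left, mul_add]
  smul_left c φ hφ ψ hψ := by
    obtain ⟨h₁, l₁, hh₁⟩ := hD.exists_isHarmonicExtension hFA hFn hφ
    obtain ⟨h₂, l₂, hh₂⟩ := hD.exists_isHarmonicExtension hFA hFn hψ
    rw [hD.trace_energy_eq hF hFA hFn (hh₁.smul c) hh₂, hD.trace_energy_eq hF hFA hFn hh₁ hh₂,
      real_inner_smul_left]
    ring
  symm φ hφ ψ hψ := by
    obtain ⟨h₁, l₁, hh₁⟩ := hD.exists_isHarmonicExtension hFA hFn hφ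
    obtain ⟨h₂, l₂, hh₂⟩ := hD.exists_isHarmonicExtension hFA hFn hψ
    rw [hD.trace_energy_eq hF hFA hFn hh₁ hh₂, hD.trace_energy_eq hF hFA hFn hh₂ hh₁,
      real_inner_comm]
  nonneg φ hφ := by
    obtain ⟨h, l, hh⟩ := hD.exists_isHarmonicExtension hFA hFn hφ
    rw [hD.trace_energy_self hF hFA hFn hh]
    positivity
  closed := hD.trace_closed hF hFA hFn
  markov φ hφ ψ hψ := by
    obtain ⟨h, l, hh⟩ := hD.exists_isHarmonicExtension hFA hFn hφ
    -- The truncated harmonic extension is an extension of `ψ` with no more energy; passing to the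
    -- trace can only lower it.
    have hfe := hh.isHarmonicOff.finiteEnergy.comp (T := fun t => max 0 (min t 1))
      (fun x y => by simpa only [min_comm _ (1 : ℝ)] using abs_clamp_sub_clamp_le 0 1 x y)
      (by simp)
    obtain ⟨k, hk, hkl⟩ := hh.isHarmonicOff.density.exists_of_abs_sub_le
      (v := (fun t => max 0 (min t 1)) ∘ h) (C := 1) fun x y => by
        simpa only [one_mul, Function.comp_apply, min_comm _ (1 : ℝ)] using
          abs_clamp_sub_clamp_le 0 1 (h x) (h y)
    have hae : ψ =ᵐ[μ] fun x : F => ((fun t => max 0 (min t 1)) ∘ h) x := by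
      filter_upwards [hψ, hh.ae_eq] with x h1 h2
      rw [h1, h2, Function.comp_apply]
    refine ⟨hD.mem_trace_domain hfe hae, (hD.trace_energy_le hF hFA hFn hfe hk hae).trans ?_⟩
    rw [hD.trace_energy_self hF hFA hFn hh]
    rw [one_mul] at hkl
    gcongr
  dense_domain φ hφ ε hε := hD.trace_dense_domain hFc hF hFA hFn hφ hε
  dense_compactSupport f hf hfs ε hε := by
    have : Nonempty F := hFn.to_subtype
    obtain ⟨u, hu, hus, huf⟩ := exists_finiteEnergy_near hD.measurableSet hD.pos hf hfs hε
    have huL := memLp_restrict (μ := μ) hFc hu.continuous hus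
    exact ⟨fun x => u x, hu.continuous.comp continuous_subtype_val,
      hus.comp_isClosedEmbedding hFc.isClosedEmbedding_subtypeVal,
      ⟨huL.toLp _, hD.mem_trace_domain hu huL.coeFn_toLp, huL.coeFn_toLp⟩, fun x => (huf x).1⟩

end IsEnergyForm

/-! ## Brownian motion and scale functions -/

theorem continuousVersion_eq {f u : ℝ → ℝ} (hu : Continuous u) (hf : f =ᵐ[volume] u) :
    continuousVersion f = u := by
  have h := Classical.epsilon_spec (p := fun u => Continuous u ∧ f =ᵐ[volume] u) ⟨u, hu, hf⟩
  exact (h.1.ae_eq_iff_eq volume hu).1 (h.2.symm.trans hf)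

theorem isEnergyForm_brownianForm : IsEnergyForm univ brownianForm where
  measurableSet := MeasurableSet.univ
  pos a b hab := by simpa using hab
  mem_domain_iff f := by
    constructor
    · rintro ⟨u, hf, hac, hmem⟩
      exact ⟨u, _, hasL2Density_of_absolutelyContinuous hac hmem
        (Eventually.of_forall fun x hx => absurd (mem_univ x) hx), hf⟩
    · rintro ⟨u, g, hu, hf⟩
      exact ⟨u, hf, hu.absolutelyContinuous, (memLp_congr_ae hu.deriv_ae_eq).2 (Lp.memLp g)⟩
  energy_eq {f f' u u' g g'} hu hu' hf hf' := by
    change 1 / 2 * ∫ x, deriv (continuousVersion f) x * deriv (continuousVersion f') x = _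
    rw [continuousVersion_eq hu.continuous hf, continuousVersion_eq hu'.continuous hf',
      L2.inner_def]
    congr 1
    refine integral_congr_ae ?_
    filter_upwards [hu.deriv_ae_eq, hu'.deriv_ae_eq] with x h1 h2
    rw [h1, h2, RCLike.inner_apply, conj_trivial, mul_comm]

theorem intervalIntegral_restrict_eq_indicator {G : Set ℝ} (hG : MeasurableSet G) (g : ℝ → ℝ)
    (x y : ℝ) : ∫ t in x..y, g t ∂(volume.restrict G) = ∫ t in x..y, G.indicator g t := by
  simp only [intervalIntegral, Measure.restrict_restrict measurableSet_Ioc,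
    setIntegral_indicator hG]

theorem locallyIntegrable_indicator_iff_restrict {G : Set ℝ} (hG : MeasurableSet G) {g : ℝ → ℝ} :
    LocallyIntegrable (G.indicator g) volume ↔ LocallyIntegrable g (volume.restrict G) := by
  refine forall_congr' fun x => exists_congr fun t => and_congr_right fun _ => ?_
  rw [IntegrableOn, integrable_indicator_iff hG, IntegrableOn, IntegrableOn,
    Measure.restrict_restrict hG, Measure.restrict_restrict' hG, inter_comm]

section Scale

variable {s : StieltjesFunction ℝ} {G : Set ℝ}

/-- By absolute continuity s(b) - s(a) is the integral of s', that is |G ∩ (a, b]|, and such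
intervals determine the measure. -/
theorem StieltjesFunction.measure_eq_restrict
    (hs_ac : ∀ a b, AbsolutelyContinuousOnInterval s a b)
    (hs_deriv : ∀ᵐ x : ℝ, deriv s x = 0 ∨ deriv s x = 1) (hGm : MeasurableSet G)
    (hG : G =ᵐ[volume] {x : ℝ | deriv s x = 1}) : s.measure = volume.restrict G := by
  have hderiv : deriv s =ᵐ[volume] G.indicator fun _ => 1 := by
    filter_upwards [hs_deriv, hG] with x h1 h2
    have h3 : x ∈ G ↔ deriv s x = 1 := Iff.of_eq h2
    by_cases hx : x ∈ G
    · rw [indicator_of_mem hx, h3.1 hx]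
    · rw [indicator_of_notMem hx]
      exact h1.resolve_right fun h => hx (h3.2 h)
  refine Measure.ext_of_Ioc _ _ fun a b hab => ?_
  rw [StieltjesFunction.measure_Ioc, ← (hs_ac a b).integral_deriv_eq_sub,
    intervalIntegral.integral_congr_ae (hderiv.mono fun x hx _ => hx),
    intervalIntegral.integral_of_le hab.le, integral_indicator_const _ hGm, smul_eq_mul, mul_one,
    Measure.restrict_apply measurableSet_Ioc, measureReal_restrict_apply hGm,
    ofReal_measureReal (volume_inter_Ioc_ne_top G a b), inter_comm]

theorem IsScaleDeriv.ae_hasDerivAt (hs : s.measure = volume.restrict G) (hGm : MeasurableSet G)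
    {u g : ℝ → ℝ} (hg : IsScaleDeriv s u g) : ∀ᵐ x, HasDerivAt u (G.indicator g x) x := by
  obtain ⟨h1, h2⟩ := hg
  rw [hs, ← locallyIntegrable_indicator_iff_restrict hGm] at h1
  filter_upwards [LocallyIntegrable.ae_hasDerivAt_integral h1] with x hx
  have h3 : u = fun y => u 0 + ∫ t in (0 : ℝ)..y, G.indicator g t := by
    ext y
    rw [← intervalIntegral_restrict_eq_indicator hGm, ← hs, ← h2]
    ring
  rw [h3]
  exact (hx 0).const_add _

theorem HasL2Density.isScaleDeriv (hs : s.measure = volume.restrict G) (hGm : MeasurableSet G)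
    {u : ℝ → ℝ} {g : Lp ℝ 2 (volume : Measure ℝ)} (hu : HasL2Density G u g) :
    IsScaleDeriv s u g := by
  have hind : G.indicator g =ᵐ[volume] g := by
    filter_upwards [hu.ae_eq_zero] with x hx
    by_cases hxG : x ∈ G
    · rw [indicator_of_mem hxG]
    · rw [indicator_of_notMem hxG, hx hxG]
  refine ⟨?_, fun x y => ?_⟩
  · rw [hs, ← locallyIntegrable_indicator_iff_restrict hGm]
    exact (Lp.locallyIntegrable_two g).congr hind.symm
  · rw [hs, intervalIntegral_restrict_eq_indicator hGm, hu.sub_eq]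
    exact intervalIntegral.integral_congr_ae (hind.mono fun x hx _ => hx.symm)

theorem IsScaleDeriv.scaleDeriv {u g : ℝ → ℝ} (hg : IsScaleDeriv s u g) :
    IsScaleDeriv s u (scaleDeriv s u) :=
  Classical.epsilon_spec (p := fun g => IsScaleDeriv s u g) ⟨g, hg⟩

/-- Both sides are the a.e. derivative of `u`, so the choice made in `scaleDeriv` is immaterial. -/
theorem HasL2Density.indicator_scaleDeriv (hs : s.measure = volume.restrict G)
    (hGm : MeasurableSet G) {u : ℝ → ℝ} {g : Lp ℝ 2 (volume : Measure ℝ)}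
    (hu : HasL2Density G u g) : G.indicator (scaleDeriv s u) =ᵐ[volume] g := by
  filter_upwards [(hu.isScaleDeriv hs hGm).scaleDeriv.ae_hasDerivAt hs hGm, hu.ae_hasDerivAt]
    with x h1 h2 using h1.unique h2

theorem isEnergyForm_scaleForm (hs : s.measure = volume.restrict G) (hGm : MeasurableSet G)
    (hs_mono : StrictMono s) : IsEnergyForm G (scaleForm s) where
  measurableSet := hGm
  pos a b hab := by
    obtain ⟨c, hac, hcb⟩ := exists_between hab
    have h1 : 0 < s.measure (Ioc a c) := by
      rw [StieltjesFunction.measure_Ioc]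
      exact ENNReal.ofReal_pos.2 (sub_pos.2 (hs_mono hac))
    rw [hs, Measure.restrict_apply measurableSet_Ioc, inter_comm] at h1
    exact h1.trans_le (measure_mono (inter_subset_inter_right _
      (Ioc_subset_Ioo_right hcb)))
  mem_domain_iff f := by
    constructor
    · rintro ⟨u, hu, hf, ⟨g, hg⟩, hmem⟩
      have hsd := hg.scaleDeriv
      rw [hs, ← memLp_indicator_iff_restrict hGm] at hmem
      refine ⟨u, hmem.toLp _, ⟨?_, fun x y => ?_⟩, hf⟩
      · filter_upwards [hmem.coeFn_toLp] with x h1 h2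
        rw [h1, indicator_of_notMem h2]
      · rw [hsd.2 x y, hs, intervalIntegral_restrict_eq_indicator hGm]
        exact intervalIntegral.integral_congr_ae (hmem.coeFn_toLp.mono fun x hx _ => hx.symm)
    · rintro ⟨u, g, hu, hf⟩
      refine ⟨u, hu.continuous, hf, ⟨g, hu.isScaleDeriv hs hGm⟩, ?_⟩
      rw [hs, ← memLp_indicator_iff_restrict hGm]
      exact (memLp_congr_ae (hu.indicator_scaleDeriv hs hGm)).2 (Lp.memLp g)
  energy_eq {f f' u u' g g'} hu hu' hf hf' := by
    change 1 / 2 * ∫ x, scaleDeriv s (continuousVersion f) x *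
      scaleDeriv s (continuousVersion f') x ∂s.measure = _
    rw [continuousVersion_eq hu.continuous hf, continuousVersion_eq hu'.continuous hf',
      L2.inner_def, hs, ← integral_indicator hGm]
    congr 1
    refine integral_congr_ae ?_
    filter_upwards [hu.indicator_scaleDeriv hs hGm, hu'.indicator_scaleDeriv hs hGm] with x h1 h2
    rw [RCLike.inner_apply, conj_trivial, mul_comm, ← h1, ← h2, indicator_mul]

end Scale

/-! ### Tent functions and strictness of the inclusion -/

theorem indicatorPrimitive_univ (x : ℝ) : indicatorPrimitive univ x = x := by
  simp [indicatorPrimitive]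

theorem hasCompactSupport_tent (N : ℝ) : HasCompactSupport fun x : ℝ => max 0 (N - |x|) :=
  HasCompactSupport.of_support_subset_isCompact (isCompact_Icc (a := -N) (b := N))
    fun x hx => abs_le.1 <| by
      by_contra h
      exact hx (max_eq_left (by linarith [not_le.1 h]))

/-- The tent function of height and half-width `N`. -/
theorem finiteEnergy_tent (N : ℝ) : FiniteEnergy univ fun x => max 0 (N - |x|) := by
  refine FiniteEnergy.of_abs_sub_le_indicatorPrimitive MeasurableSet.univ (C := 1)
    (hasCompactSupport_tent N) fun x y => ?_
  rw [indicatorPrimitive_univ, indicatorPrimitive_univ, one_mul]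
  refine (abs_max_sub_max_le_max _ _ _ _).trans ?_
  rw [sub_self, abs_zero, max_eq_right (abs_nonneg _), sub_sub_sub_cancel_left, abs_sub_comm y x]
  exact abs_abs_sub_abs_le x y

theorem deriv_tent_ne_zero {N x : ℝ} (hx : x ≠ 0) (hxN : |x| < N) :
    deriv (fun x => max 0 (N - |x|)) x ≠ 0 := by
  have h1 : (fun x => max 0 (N - |x|)) =ᶠ[𝓝 x] fun x => N - |x| := by
    filter_upwards [(continuous_abs.isOpen_preimage _ isOpen_Iio).mem_nhds hxN] with y hy
    exact max_eq_right (sub_nonneg.2 (le_of_lt hy))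
  rw [h1.deriv_eq]
  rcases lt_or_gt_of_ne hx with h | h
  · have h2 := ((hasDerivAt_abs_neg h).const_sub N).deriv
    rw [h2]; norm_num
  · have h2 := ((hasDerivAt_abs_pos h).const_sub N).deriv
    rw [h2]; norm_num

/-- If `F` has positive measure, the forms on `Fᶜ` have strictly smaller traces than the Dirichlet
integral. -/
theorem IsEnergyForm.trace_domain_ne {F : Set ℝ} {μ : Measure F} [μ.IsOpenPosMeasure]
    [IsLocallyFiniteMeasure μ] {D D' : L2Form (volume : Measure ℝ)} (hD : IsEnergyForm Fᶜ D)
    (hD' : IsEnergyForm univ D') (hFc : IsClosed F) (hF : Preperfect F) (hFpos : 0 < volume F) :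
    (D.trace F μ).domain ≠ (D'.trace F μ).domain := by
  intro heq
  refine hFpos.ne' ?_
  have key : ∀ N : ℕ, ∀ᵐ x, x ∈ F → ¬ |x| < N := fun N => by
    have hu := finiteEnergy_tent N
    set u : ℝ → ℝ := fun x => max 0 (N - |x|) with hu_def
    have huL := memLp_restrict (μ := μ) hFc hu.continuous (hasCompactSupport_tent N)
    obtain ⟨v, hv, hφv⟩ := heq.symm ▸ hD'.mem_trace_domain hu huL.coeFn_toLp
    rw [hD.mem_extendedSpace_iff] at hv
    have huv : ∀ x ∈ F, (u - v) x = 0 := fun x hx => sub_eq_zero.2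
      (eqOn_of_ae_eq hu.continuous hv.continuous (huL.coeFn_toLp.symm.trans hφv) x hx)
    obtain ⟨g, hg⟩ := hu.exists_density
    obtain ⟨k, hk⟩ := hv.exists_density
    -- On `F` the densities of `u` and `v` agree a.e., and that of `v` is zero, against the slope of
    -- the tent.
    have h1 := (hg.sub (hk.mono (subset_univ _))).ae_eq_zero_of_preperfect hF huv
    filter_upwards [h1, hk.ae_eq_zero, hg.deriv_ae_eq, Lp.coeFn_sub g k,
      compl_mem_ae_iff.2 (measure_singleton (0 : ℝ))] with x h1 h2 h3 h4 h5 hxF hxN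
    refine deriv_tent_ne_zero h5 hxN ?_
    rw [← hu_def, h3]
    have h6 := h1 hxF
    rw [h4, Pi.sub_apply, h2 (not_not.2 hxF), sub_zero] at h6
    exact h6
  refine measure_eq_zero_iff_ae_notMem.2 ?_
  filter_upwards [ae_all_iff.2 key] with x hx hxF
  obtain ⟨N, hN⟩ := exists_nat_gt |x|
  exact hx N hxF hN

/-! ### The main theorem -/

theorem theorem2p2
    (s : StieltjesFunction ℝ) (hs_mono : StrictMono s)
    (hs_ac : ∀ a b, AbsolutelyContinuousOnInterval s a b)
    (hs_deriv : ∀ᵐ x : ℝ, deriv s x = 0 ∨ deriv s x = 1)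
    (G : Set ℝ) (hG_open : IsOpen G)
    (hG : G =ᵐ[volume] {x : ℝ | deriv s x = 1})
    (hF_pos : 0 < volume Gᶜ)
    (hF_isol : Preperfect Gᶜ)
    (μ : Measure ↥Gᶜ) [IsLocallyFiniteMeasure μ] (hμ : μ.support = Set.univ) :
    L2Form.IsProperRegularSubspace ((scaleForm s).trace Gᶜ μ) (brownianForm.trace Gᶜ μ) ∧
    (∀ u ∈ brownianForm.extendedSpace, ∃! h, brownianForm.IsHarmonicPart Gᶜ u h) ∧
    (∀ u ∈ (scaleForm s).extendedSpace, ∃! h, (scaleForm s).IsHarmonicPart Gᶜ u h) ∧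
    (∀ u ∈ (scaleForm s).extendedSpace, u ∈ brownianForm.extendedSpace ∧
      brownianForm.harmonicPart Gᶜ u = (scaleForm s).harmonicPart Gᶜ u) := by
  have hGm := hG_open.measurableSet
  have hD := isEnergyForm_scaleForm
    (StieltjesFunction.measure_eq_restrict hs_ac hs_deriv hGm hG) hGm hs_mono
  have hB := isEnergyForm_brownianForm
  have hFc : IsClosed Gᶜ := hG_open.isClosed_compl
  have hFn : (Gᶜ).Nonempty := nonempty_of_measure_ne_zero hF_pos.ne'
  have hFG : Gᶜᶜ ⊆ G := (compl_compl G).subset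
  have hFU : Gᶜᶜ ⊆ univ := subset_univ _
  have : μ.IsOpenPosMeasure := ⟨fun U hU ⟨x, hx⟩ =>
    ((Measure.mem_support_iff_forall x).1 (hμ ▸ mem_univ x) U (hU.mem_nhds hx)).ne'⟩
  refine ⟨⟨⟨hD.isRegularDirichletForm_trace hFc hF_isol hFG hFn,
    hB.isRegularDirichletForm_trace hFc hF_isol hFU hFn, ?_, ?_⟩, ?_⟩, ?_, ?_, ?_⟩
  · rintro φ ⟨u, hu, hφ⟩
    exact hB.mem_trace_domain ((hD.mem_extendedSpace_iff.1 hu).mono (subset_univ _)) hφ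
  -- A harmonic extension for the form of `s` is one for Brownian motion with the same density, so
  -- both energies are the same inner product.
  · intro φ hφ ψ hψ
    obtain ⟨h, l, hh, hφh⟩ := hD.exists_isHarmonicExtension hFG hFn hφ
    obtain ⟨h', l', hh', hψh⟩ := hD.exists_isHarmonicExtension hFG hFn hψ
    rw [hD.trace_energy_eq hF_isol hFG hFn ⟨hh, hφh⟩ ⟨hh', hψh⟩,
      hB.trace_energy_eq hF_isol hFU hFn ⟨hh.mono (subset_univ _), hφh⟩
        ⟨hh'.mono (subset_univ _), hψh⟩]
  · refine IsEnergyForm.trace_domain_ne ?_ hB hFc hF_isol hF_pos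
    rwa [compl_compl]
  · exact fun u hu => hB.existsUnique_isHarmonicPart hF_isol hFU hFn (hB.mem_extendedSpace_iff.1 hu)
  · exact fun u hu => hD.existsUnique_isHarmonicPart hF_isol hFG hFn (hD.mem_extendedSpace_iff.1 hu)
  · intro u hu
    rw [hD.mem_extendedSpace_iff] at hu
    exact ⟨hB.mem_extendedSpace_iff.2 (hu.mono (subset_univ _)),
      hD.harmonicPart_eq hB hF_isol hFG (subset_univ _) hFn hu⟩
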